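/- **Theorem 1.6.** All graphs are finite and simple. For $k\ge 3$ let $W_{k+1}=K_1\nabla C_k$ be the wheel on $k+1$ vertices, where $\nabla$ denotes the join of graphs and $C_k$ the cycle of length $k$. For a graph $H$, let $SPEX(n,\{H\}_{minor})$ be the set of all $n$-vertex graphs that do not contain $H$ as a minor and whose adjacency matrix has the largest spectral radius among all such $n$-vertex graphs. Let $B_{s,t}$ be the book obtained by joining every vertex of a clique on $s$ vertices to every vertex of an independent set of $t$ vertices, and let $B^1_{s,t}$ be obtained from $B_{s,t}$ by adding one edge inside its independent set. Let $k\ge 3$ with $k\ne 4$, and put $\gamma=\lceil k/2\rceil$. Then there is an integer $N$, depending only on $k$, such that for every $n\ge N$ the following hold, up to isomorphism. 1. If $k$ is odd, then $SPEX(n,\{W_{k+1}\}_{minor})=\{B_{\gamma,n-\gamma}\}$. 2. If $k$ is even, then $SPEX(n,\{W_{k+1}\}_{minor})=\{B^1_{\gamma,n-\gamma}\}$. -/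

import Mathlib

namespace SpectralMinor

/-- `H` is a minor of `G`: there is a model of `H` in `G`, that is, pairwise disjoint vertex sets
`B x` of `G`, one for each vertex `x` of `H`, each inducing a connected (so nonempty) subgraph,
with an edge of `G` between `B x` and `B y` whenever `x` and `y` are adjacent in `H`. -/
def IsMinor {W V : Type*} (H : SimpleGraph W) (G : SimpleGraph V) : Prop :=
  ∃ B : W → Set V,
    (∀ x, (G.induce (B x)).Connected) ∧
    (∀ x y, x ≠ y → Disjoint (B x) (B y)) ∧
    (∀ x y, H.Adj x y → ∃ u ∈ B x, ∃ v ∈ B y, G.Adj u v)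

/-- The join of two graphs: their disjoint union together with all edges between them. -/
def join {V W : Type*} (G : SimpleGraph V) (H : SimpleGraph W) : SimpleGraph (V ⊕ W) :=
  G.sum H ⊔ completeBipartiteGraph V W

/-- The wheel with `k + 1` vertices, `K₁` joined to the cycle of length `k` (for `3 ≤ k`). -/
def wheel (k : ℕ) : SimpleGraph (Fin 1 ⊕ Fin k) :=
  join (⊤ : SimpleGraph (Fin 1)) (SimpleGraph.cycleGraph k)

/-- The book: a clique on `s` vertices joined to an independent set of `t` vertices. -/
def book (s t : ℕ) : SimpleGraph (Fin s ⊕ Fin t) :=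
  join (⊤ : SimpleGraph (Fin s)) (⊥ : SimpleGraph (Fin t))

/-- The graph on `t` vertices whose only edge joins the vertices `0` and `1` (for `2 ≤ t`). -/
def oneEdge (t : ℕ) : SimpleGraph (Fin t) :=
  SimpleGraph.fromRel fun i j => i.val = 0 ∧ j.val = 1

/-- The book with one extra edge inside its independent set. -/
def bookOne (s t : ℕ) : SimpleGraph (Fin s ⊕ Fin t) :=
  join (⊤ : SimpleGraph (Fin s)) (oneEdge t)

open Classical in
/-- The spectral radius of a finite graph: the largest absolute value of an eigenvalue of its
adjacency matrix. This matrix is real symmetric, so all its eigenvalues are real. -/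
noncomputable def graphSpectralRadius {V : Type*} [Fintype V] [DecidableEq V]
    (G : SimpleGraph V) : ENNReal :=
  spectralRadius ℝ (G.adjMatrix ℝ)

/-- The extremal graphs on the vertex set `Fin n`: the `H`-minor-free graphs whose spectral radius
is maximal among all `H`-minor-free graphs with `n` vertices. -/
def SPEX (n : ℕ) {W : Type*} (H : SimpleGraph W) : Set (SimpleGraph (Fin n)) :=
  {G | ¬ IsMinor H G ∧
    ∀ G' : SimpleGraph (Fin n), ¬ IsMinor H G' → graphSpectralRadius G' ≤ graphSpectralRadius G}

end SpectralMinor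

namespace SpectralMinor

/-! Write g = ⌈k/2⌉. The books of the theorem have no wheel minor: once the g clique vertices are
deleted, at most k + 1 - 2g edges remain, and a wheel model would need more (`not_isMinor_wheel`).

Let G be extremal, with spectral radius ρ and nonnegative eigenvector x scaled to maximum 1.
Comparison with the book gives ρ² ≥ g(n - g). Wheel-minor-free graphs have linearly many edges
(`isMinor_wheel_of_many_edges`), and g + 1 vertices have at most g common neighbours, since a
complete bipartite graph with both parts of size g + 1 contains the wheel
(`isMinor_wheel_of_complete_pair`). Counting walks of length two then shows that x is concentrated
on a set L of exactly g vertices with many common neighbours R, and is at most a small δ elsewhere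
(`exists_core`).

The complete pair L, R almost contains the wheel, so a little extra structure completes it. For odd
k, R spans no edge and a vertex outside L has at most one neighbour in R. For even k, R spans at
most one edge and a vertex outside L and R has at most two neighbours in R. Excluding two disjoint
edges in R needs g ≥ 3; this is where k ≠ 4 enters.

Finally G is compared with the book on L. A vertex outside L and R misses some vertex of L, whose
entry is at least 1/2; joining the two gains more in the quadratic form than is lost with the edges
among small entries (`adjForm_add_le_bookOn`). As the book is also wheel-minor-free, maximality of ρ
forces G to be the book (`eq_bookOn`). -/

/-- Some edge of `G` joins a vertex of `X` to a vertex of `Y`. -/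
def SetAdj {V : Type*} (G : SimpleGraph V) (X Y : Set V) : Prop :=
  ∃ u ∈ X, ∃ v ∈ Y, G.Adj u v

/-! ### Wheel models from cyclic sequences of connected sets. -/

section Necklace

variable {V : Type*} {G : SimpleGraph V}

lemma SetAdj.symm {X Y : Set V} (h : SetAdj G X Y) : SetAdj G Y X := by
  obtain ⟨u, hu, v, hv, huv⟩ := h
  exact ⟨v, hv, u, hu, huv.symm⟩

lemma SetAdj.mono {X Y X' Y' : Set V} (h : SetAdj G X Y) (hX : X ⊆ X') (hY : Y ⊆ Y') :
    SetAdj G X' Y' := by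
  obtain ⟨u, hu, v, hv, huv⟩ := h
  exact ⟨u, hX hu, v, hY hv, huv⟩

lemma connected_union_of_setAdj {X Y : Set V} (hX : (G.induce X).Connected)
    (hY : (G.induce Y).Connected) (h : SetAdj G X Y) : (G.induce (X ∪ Y)).Connected := by
  obtain ⟨u, hu, v, hv, huv⟩ := h
  exact SimpleGraph.connected_induce_union hX.preconnected hY.preconnected hu hv huv

lemma connected_induce_singleton (v : V) : (G.induce {v}).Connected := by
  have : Unique ({v} : Set V) := inferInstance
  exact SimpleGraph.Connected.mk (SimpleGraph.Preconnected.of_subsingleton)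

lemma wheel_adj_inl_inr {k : ℕ} (a : Fin 1) (i : Fin k) : (wheel k).Adj (.inl a) (.inr i) := by
  simp [wheel, join]

lemma wheel_adj_inr_inr {k : ℕ} (i j : Fin k) :
    (wheel k).Adj (.inr i) (.inr j) ↔ (SimpleGraph.cycleGraph k).Adj i j := by
  simp [wheel, join]

lemma not_wheel_adj_inl_inl {k : ℕ} (a b : Fin 1) : ¬ (wheel k).Adj (.inl a) (.inl b) := by
  simp [wheel, join, Subsingleton.elim a b]

/-- Subtraction in `Fin k` wraps around; resolving it once leaves only successor steps and the
closing step from `k - 1` to `0`. -/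
lemma cycleGraph_adj_cases {k : ℕ} {i j : Fin k}
    (h : (SimpleGraph.cycleGraph k).Adj i j) :
    (i.val + 1 = j.val ∨ (i.val + 1 = k ∧ j.val = 0)) ∨
      (j.val + 1 = i.val ∨ (j.val + 1 = k ∧ i.val = 0)) := by
  rw [SimpleGraph.cycleGraph_adj'] at h
  have hi := i.isLt
  have hj := j.isLt
  simp only [Fin.sub_def] at h
  rcases h with h | h
  · right
    rcases lt_or_ge i.val j.val with hij | hij
    · rw [Nat.mod_eq_of_lt (by omega)] at h
      omega
    · rw [show k - j.val + i.val = (i.val - j.val) + k by omega, Nat.add_mod_right,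
        Nat.mod_eq_of_lt (by omega)] at h
      omega
  · left
    rcases lt_or_ge j.val i.val with hij | hij
    · rw [Nat.mod_eq_of_lt (by omega)] at h
      omega
    · rw [show k - i.val + j.val = (j.val - i.val) + k by omega, Nat.add_mod_right,
        Nat.mod_eq_of_lt (by omega)] at h
      omega

/-- A cyclic sequence of `k` adjacent connected sets together with a connected set adjacent to
all of them is a model of the wheel. -/
lemma isMinor_wheel_of_length_eq {k : ℕ} {S : Set V} (hS : (G.induce S).Connected)
    (l : List (Set V)) (hlen : l.length = k) (hc : ∀ b ∈ l, (G.induce b).Connected)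
    (hpw : l.Pairwise Disjoint) (hch : l.IsChain (SetAdj G))
    (hclose : ∀ z ∈ l.getLast?, ∀ a ∈ l.head?, SetAdj G z a)
    (hdisj : ∀ b ∈ l, Disjoint S b) (hadj : ∀ b ∈ l, SetAdj G S b) :
    IsMinor (wheel k) G := by
  subst hlen
  have hcyc : ∀ i j : Fin l.length, (i.val + 1 = j.val ∨ (i.val + 1 = l.length ∧ j.val = 0)) →
      SetAdj G l[i] l[j] := by
    rintro ⟨i, hi⟩ ⟨j, hj⟩ (h | ⟨h, h0⟩)
    · dsimp only at h
      subst h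
      exact List.isChain_iff_getElem.mp hch i hj
    · dsimp only at h h0
      subst h0
      apply hclose
      · rw [List.getLast?_eq_getElem?, show l.length - 1 = i by omega]
        simp
      · rw [List.head?_eq_getElem?]
        simp
  refine ⟨Sum.elim (fun _ => S) (fun i => l[i]), ?_, ?_, ?_⟩
  · rintro (a | i)
    · exact hS
    · exact hc _ (List.getElem_mem _)
  · rintro (a | i) (b | j) hne
    · exact absurd (by rw [Subsingleton.elim a b]) hne
    · exact hdisj _ (List.getElem_mem _)
    · exact (hdisj _ (List.getElem_mem _)).symm
    · have hij : i ≠ j := fun h => hne (by rw [h])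
      rcases lt_or_gt_of_ne hij with h | h
      · exact List.pairwise_iff_getElem.mp hpw i j i.2 j.2 h
      · exact (List.pairwise_iff_getElem.mp hpw j i j.2 i.2 h).symm
  · rintro (a | i) (b | j) h
    · exact absurd h (not_wheel_adj_inl_inl a b)
    · exact hadj _ (List.getElem_mem _)
    · exact (hadj _ (List.getElem_mem _)).symm
    · rw [wheel_adj_inr_inr] at h
      rcases cycleGraph_adj_cases h with h | h
      · exact hcyc i j h
      · exact (hcyc j i h).symm

/-- A cyclic sequence of at least `k` adjacent connected sets together with a connected set
adjacent to all of them yields a wheel minor. -/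
lemma isMinor_wheel_of_necklace {k : ℕ} (hk : 3 ≤ k) {S : Set V} (hS : (G.induce S).Connected)
    (l : List (Set V)) (hlen : k ≤ l.length) (hc : ∀ b ∈ l, (G.induce b).Connected)
    (hpw : l.Pairwise Disjoint) (hch : l.IsChain (SetAdj G))
    (hclose : ∀ z ∈ l.getLast?, ∀ a ∈ l.head?, SetAdj G z a)
    (hdisj : ∀ b ∈ l, Disjoint S b) (hadj : ∀ b ∈ l, SetAdj G S b) :
    IsMinor (wheel k) G := by
  induction hm : l.length - k generalizing l with
  | zero => exact isMinor_wheel_of_length_eq hS l (by omega) hc hpw hch hclose hdisj hadj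
  | succ m ih =>
    match l with
    | [] => simp at hlen; omega
    | [a] => simp at hlen; omega
    | [a, b] => simp at hlen; omega
    | a :: b :: c :: t =>
      simp only [List.mem_cons, forall_eq_or_imp] at hc hdisj hadj
      simp only [List.isChain_cons_cons] at hch
      simp only [List.pairwise_cons, List.mem_cons, forall_eq_or_imp] at hpw
      simp only [List.length_cons] at hlen hm
      -- Contracting the first two beads into one shortens the necklace by one and keeps it cyclic.
      apply ih ((a ∪ b) :: c :: t)
      · simp only [List.length_cons]; omega
      · simp only [List.mem_cons, forall_eq_or_imp]
        exact ⟨connected_union_of_setAdj hc.1 hc.2.1 hch.1, hc.2.2⟩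
      · simp only [List.pairwise_cons, List.mem_cons, forall_eq_or_imp, Set.disjoint_union_left]
        exact ⟨⟨⟨hpw.1.2.1, hpw.2.1.1⟩, fun x hx => ⟨hpw.1.2.2 x hx, hpw.2.1.2 x hx⟩⟩,
          hpw.2.2⟩
      · simp only [List.isChain_cons_cons]
        exact ⟨hch.2.1.mono Set.subset_union_right subset_rfl, hch.2.2⟩
      · intro z hz y hy
        simp only [List.head?_cons, Option.mem_def, Option.some.injEq] at hy
        subst hy
        refine (hclose z ?_ a (by simp)).mono subset_rfl Set.subset_union_left
        simpa [List.getLast?_cons_cons] using hz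
      · simp only [List.mem_cons, forall_eq_or_imp, Set.disjoint_union_right]
        exact ⟨⟨hdisj.1, hdisj.2.1⟩, hdisj.2.2⟩
      · simp only [List.mem_cons, forall_eq_or_imp]
        exact ⟨hadj.1.mono subset_rfl Set.subset_union_left, hadj.2.2⟩
      · simp only [List.length_cons]; omega

end Necklace

end SpectralMinor

/-! ### Wheel-minor-free graphs have linearly many edges. -/

namespace SpectralMinor

open Classical in
/-- The neighbours of `v` that lie in the finite set `X`. -/
noncomputable def nbrs {V : Type*} (G : SimpleGraph V) (X : Finset V) (v : V) : Finset V :=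
  X.filter (G.Adj v)

section Sparse

variable {V : Type*} {G : SimpleGraph V}

lemma mem_nbrs {X : Finset V} {v w : V} : w ∈ nbrs G X v ↔ w ∈ X ∧ G.Adj v w := by
  simp [nbrs]

lemma nbrs_subset (X : Finset V) (v : V) : nbrs G X v ⊆ X := fun _ h => (mem_nbrs.mp h).1

lemma nbrs_mono {X Y : Finset V} (h : X ⊆ Y) (v : V) : nbrs G X v ⊆ nbrs G Y v := fun _ hw =>
  mem_nbrs.mpr ⟨h (mem_nbrs.mp hw).1, (mem_nbrs.mp hw).2⟩

/-- A longest path in a set in which all degrees are at least `k - 1` closes up to a cycle of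
length at least `k`. -/
lemma exists_long_path [DecidableEq V] {k : ℕ} (hk : 3 ≤ k) {Y : Finset V} (hY : Y.Nonempty)
    (hdeg : ∀ w ∈ Y, k - 1 ≤ (nbrs G Y w).card) :
    ∃ p : List V, p.Nodup ∧ p.IsChain G.Adj ∧ (∀ v ∈ p, v ∈ Y) ∧ k ≤ p.length ∧
      ∀ z ∈ p.getLast?, ∀ a ∈ p.head?, G.Adj z a := by
  obtain ⟨v, t, hnd, hch, hsub, hmax⟩ : ∃ v t, (v :: t).Nodup ∧ (v :: t).IsChain G.Adj ∧
      (∀ u ∈ v :: t, u ∈ Y) ∧ ∀ u ∈ nbrs G Y v, u ∈ t := by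
    -- If every path in `Y` could be extended at its head, there would be paths with more than
    -- `Y.card` vertices.
    by_contra! hcon
    have key : ∀ m : ℕ, ∃ v t, (v :: t).Nodup ∧ (v :: t).IsChain G.Adj ∧
        (∀ u ∈ v :: t, u ∈ Y) ∧ t.length = m := by
      intro m
      induction m with
      | zero =>
        obtain ⟨y, hy⟩ := hY
        exact ⟨y, [], by simp, by simp, by simpa using hy, rfl⟩
      | succ m ih =>
        obtain ⟨v, t, h1, h2, h3, h4⟩ := ih
        obtain ⟨u, hu, hut⟩ := hcon v t h1 h2 h3
        rw [mem_nbrs] at hu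
        refine ⟨u, v :: t, ?_, ?_, ?_, by simp [h4]⟩
        · rw [List.nodup_cons]
          refine ⟨?_, h1⟩
          simp only [List.mem_cons, not_or]
          exact ⟨hu.2.ne', hut⟩
        · rw [List.isChain_cons_cons]
          exact ⟨hu.2.symm, h2⟩
        · intro x hx
          rcases List.mem_cons.mp hx with rfl | hx
          · exact hu.1
          · exact h3 x hx
    obtain ⟨v, t, h1, -, h3, h4⟩ := key Y.card
    have : (v :: t).toFinset.card ≤ Y.card :=
      Finset.card_le_card fun x hx => h3 x (List.mem_toFinset.mp hx)
    rw [List.toFinset_card_of_nodup h1, List.length_cons] at this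
    omega
  -- All neighbours of the head lie on the path, and the first `k - 2` places of `t` cannot hold `k
  -- - 1` of them. Cutting after a later one leaves `j + 2 ≥ k` vertices and closes the cycle.
  obtain ⟨j, hj, hkj, hadj⟩ : ∃ (j : ℕ) (hj : j < t.length), k - 2 ≤ j ∧ G.Adj v t[j] := by
    by_contra! hcon
    have h1 : nbrs G Y v ⊆ (t.take (k - 2)).toFinset := by
      intro u hu
      obtain ⟨j, hj, rfl⟩ := List.getElem_of_mem (hmax u hu)
      have : j < k - 2 := by
        by_contra! h
        exact hcon j hj h (mem_nbrs.mp hu).2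
      rw [List.mem_toFinset, List.mem_take_iff_getElem]
      exact ⟨j, by omega, rfl⟩
    have h2 := (Finset.card_le_card h1).trans (List.toFinset_card_le _)
    have h3 := hdeg v (hsub v (by simp))
    rw [List.length_take] at h2
    omega
  refine ⟨v :: t.take (j + 1), ?_, ?_, ?_, ?_, ?_⟩
  · exact hnd.sublist ((List.take_sublist _ _).cons_cons v)
  · exact (hch.take (j + 2) : _)
  · exact fun u hu => hsub u (((List.take_sublist _ _).cons_cons v).subset hu)
  · rw [List.length_cons, List.length_take]
    omega
  · intro z hz a ha
    rw [List.head?_cons, Option.mem_some_iff] at ha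
    rw [List.getLast?_eq_getElem?, List.length_cons, List.length_take,
      show min (j + 1) t.length + 1 - 1 = j + 1 by omega, List.getElem?_cons_succ,
      List.getElem?_take_of_lt (by omega), List.getElem?_eq_getElem hj, Option.mem_some_iff] at hz
    subst hz ha
    exact hadj.symm

/-- A nonempty set of minimum degree at least `k - 1`, together with a connected set that is
adjacent to all of it, contains a wheel minor. -/
lemma isMinor_wheel_of_degrees [DecidableEq V] {k : ℕ} (hk : 3 ≤ k) {S : Set V}
    (hS : (G.induce S).Connected) {Y : Finset V} (hY : Y.Nonempty)
    (hdeg : ∀ w ∈ Y, k - 1 ≤ (nbrs G Y w).card) (hdisj : ∀ w ∈ Y, w ∉ S)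
    (hadj : ∀ w ∈ Y, ∃ u ∈ S, G.Adj u w) : IsMinor (wheel k) G := by
  obtain ⟨p, hnd, hch, hsub, hlen, hclose⟩ := exists_long_path hk hY hdeg
  refine isMinor_wheel_of_necklace hk hS (p.map fun v => {v}) (by simpa using hlen) ?_ ?_ ?_ ?_ ?_ ?_
  · intro b hb
    obtain ⟨v, -, rfl⟩ := List.mem_map.mp hb
    exact connected_induce_singleton v
  · rw [List.pairwise_map]
    exact hnd.imp fun h => by simpa using h
  · rw [List.isChain_map]
    exact hch.imp fun a b h => ⟨a, rfl, b, rfl, h⟩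
  · intro z hz a ha
    rw [List.getLast?_map] at hz
    rw [List.head?_map] at ha
    obtain ⟨z, hz', rfl⟩ := Option.map_eq_some_iff.mp hz
    obtain ⟨a, ha', rfl⟩ := Option.map_eq_some_iff.mp ha
    exact ⟨z, rfl, a, rfl, hclose z hz' a ha'⟩
  · intro b hb
    obtain ⟨v, hv, rfl⟩ := List.mem_map.mp hb
    exact Set.disjoint_singleton_right.mpr (hdisj v (hsub v hv))
  · intro b hb
    obtain ⟨v, hv, rfl⟩ := List.mem_map.mp hb
    obtain ⟨u, hu, huv⟩ := hadj v (hsub v hv)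
    exact ⟨u, hu, v, rfl, huv⟩

/-- The degree sum counts each edge twice, so deleting `w` removes twice its degree. -/
lemma sum_card_nbrs_erase [DecidableEq V] {X : Finset V} {w : V} (hw : w ∈ X) :
    ∑ v ∈ X, (nbrs G X v).card =
      ∑ v ∈ X.erase w, (nbrs G (X.erase w) v).card + 2 * (nbrs G X w).card := by
  classical
  have h1 : ∀ v ∈ X.erase w, (nbrs G X v).card =
      (nbrs G (X.erase w) v).card + if G.Adj w v then 1 else 0 := by
    intro v hv
    have : nbrs G (X.erase w) v = (nbrs G X v).erase w := by
      ext u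
      simp only [mem_nbrs, Finset.mem_erase]
      tauto
    rw [this]
    split_ifs with h
    · rw [Finset.card_erase_add_one (mem_nbrs.mpr ⟨hw, h.symm⟩)]
    · rw [Finset.erase_eq_of_notMem fun h' => h (mem_nbrs.mp h').2.symm, add_zero]
  have h2 : ∑ v ∈ X.erase w, (if G.Adj w v then 1 else 0) = (nbrs G X w).card := by
    rw [Finset.sum_boole, Nat.cast_id]
    congr 1
    ext u
    simp only [mem_nbrs, Finset.mem_filter, Finset.mem_erase]
    exact ⟨fun h => ⟨h.1.2, h.2⟩, fun h => ⟨⟨h.2.ne', h.1⟩, h.2⟩⟩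
  rw [← Finset.add_sum_erase _ _ hw, Finset.sum_congr rfl h1, Finset.sum_add_distrib, h2]
  ring

/-- A set spanning at least `k - 1` times as many edges as it has vertices contains a wheel
minor. -/
lemma isMinor_wheel_of_many_edges [DecidableEq V] {k : ℕ} (hk : 3 ≤ k) {X : Finset V}
    (hX : X.Nonempty) (hedges : 2 * (k - 1) * X.card ≤ ∑ v ∈ X, (nbrs G X v).card) :
    IsMinor (wheel k) G := by
  classical
  by_contra hno
  induction hm : X.card using Nat.strong_induction_on generalizing X with
  | _ m ih =>
  subst hm
  set bd : Finset V → Finset V := fun S => (X \ S).filter fun w => ∃ u ∈ S, G.Adj u w with hbd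
  -- Contract `S` to one vertex: the quotient of `X` has `|X| - |S| + 1` vertices, and its edges are
  -- those inside `X \ S` plus one for each vertex of `bd S`. `F` collects the connected `S` whose
  -- quotient is still dense; a maximal one serves as the hub.
  set F : Finset (Finset V) := X.powerset.filter fun S =>
    (G.induce (S : Set V)).Connected ∧
    2 * (k - 1) * (X.card - S.card + 1) ≤
      ∑ v ∈ X \ S, (nbrs G (X \ S) v).card + 2 * (bd S).card with hF
  have hFne : F.Nonempty := by
    obtain ⟨v, hv⟩ := hX
    refine ⟨{v}, ?_⟩
    rw [hF, Finset.mem_filter, Finset.mem_powerset, Finset.singleton_subset_iff]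
    refine ⟨hv, ?_, ?_⟩
    · rw [Finset.coe_singleton]
      exact connected_induce_singleton v
    · have h1 : bd {v} = nbrs G X v := by
        ext w
        simp only [hbd, Finset.mem_filter, Finset.mem_sdiff, Finset.mem_singleton,
          exists_eq_left, mem_nbrs]
        exact ⟨fun h => ⟨h.1.1, h.2⟩, fun h => ⟨⟨h.1, h.2.ne'⟩, h.2⟩⟩
      rw [h1, Finset.sdiff_singleton_eq_erase, ← sum_card_nbrs_erase hv, Finset.card_singleton,
        Nat.sub_add_cancel (Finset.card_pos.mpr ⟨v, hv⟩)]
      exact hedges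
  obtain ⟨S, hSF, hSmax⟩ := F.exists_max_image Finset.card hFne
  rw [hF, Finset.mem_filter, Finset.mem_powerset] at hSF
  obtain ⟨hSX, hSc, hSe⟩ := hSF
  have hcard : (X \ S).card = X.card - S.card := Finset.card_sdiff_of_subset hSX
  have hSle := Finset.card_le_card hSX
  have hSpos : 0 < S.card := by
    obtain ⟨⟨v, hv⟩⟩ := hSc.nonempty
    exact Finset.card_pos.mpr ⟨v, hv⟩
  -- With empty boundary, `X \ S` would itself be a smaller dense set, excluded by induction.
  have hYne : (bd S).Nonempty := by
    rw [Finset.nonempty_iff_ne_empty]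
    intro h0
    rw [h0, Finset.card_empty, mul_zero, add_zero, ← hcard] at hSe
    rcases (X \ S).eq_empty_or_nonempty with h | h
    · rw [h] at hSe
      simp at hSe
      omega
    · refine ih _ ?_ h ?_ rfl
      · omega
      · exact le_trans (Nat.mul_le_mul_left _ (Nat.le_succ _)) hSe
  refine hno (isMinor_wheel_of_degrees hk hSc hYne ?_ ?_ ?_)
  · intro w hw
    have hw' := hw
    simp only [hbd, Finset.mem_filter, Finset.mem_sdiff] at hw'
    obtain ⟨⟨hwX, hwS⟩, u, huS, huw⟩ := hw'
    have hins : (insert w S).card = S.card + 1 := Finset.card_insert_of_notMem hwS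
    have hinsX : insert w S ⊆ X := Finset.insert_subset hwX hSX
    have hinsle := Finset.card_le_card hinsX
    have hnot : insert w S ∉ F := fun h => by
      have := hSmax _ h
      omega
    have hconn : (G.induce ((insert w S : Finset V) : Set V)).Connected := by
      rw [Finset.coe_insert, Set.insert_eq]
      exact connected_union_of_setAdj (connected_induce_singleton w) hSc
        ⟨w, rfl, u, huS, huw.symm⟩
    -- By maximality, contracting `w` into `S` as well must lose more than `k - 1` edges. It loses
    -- at most the edge from `w` to the hub and one edge for each neighbour of `w` in `bd S`, so
    -- there are at least `k - 1` such neighbours.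
    have hlt : ∑ v ∈ X \ insert w S, (nbrs G (X \ insert w S) v).card +
        2 * (bd (insert w S)).card < 2 * (k - 1) * (X.card - S.card) := by
      by_contra! h
      apply hnot
      rw [hF, Finset.mem_filter, Finset.mem_powerset]
      refine ⟨hinsX, hconn, ?_⟩
      rw [hins, show X.card - (S.card + 1) + 1 = X.card - S.card by omega]
      exact h
    have herase : X \ insert w S = (X \ S).erase w := by
      ext x
      simp only [Finset.mem_sdiff, Finset.mem_insert, Finset.mem_erase]
      tauto
    have hsum := sum_card_nbrs_erase (G := G) (Finset.mem_sdiff.mpr ⟨hwX, hwS⟩)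
    rw [← herase] at hsum
    have hbd' : (bd S).erase w ∪ (nbrs G (X \ S) w \ nbrs G (bd S) w) ⊆ bd (insert w S) := by
      intro x hx
      simp only [hbd, Finset.mem_union, Finset.mem_erase, Finset.mem_sdiff, mem_nbrs,
        Finset.mem_filter, Finset.mem_insert] at hx ⊢
      rcases hx with ⟨hxw, ⟨hxX, hxS⟩, y, hy, hyx⟩ | ⟨⟨⟨hxX, hxS⟩, hwx⟩, -⟩
      · exact ⟨⟨hxX, by tauto⟩, y, Or.inr hy, hyx⟩
      · exact ⟨⟨hxX, not_or.mpr ⟨hwx.ne', hxS⟩⟩, w, Or.inl rfl, hwx⟩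
    have hdj : Disjoint ((bd S).erase w) (nbrs G (X \ S) w \ nbrs G (bd S) w) := by
      rw [Finset.disjoint_left]
      intro x hx hx'
      rw [Finset.mem_sdiff, mem_nbrs, mem_nbrs] at hx'
      exact hx'.2 ⟨Finset.mem_of_mem_erase hx, hx'.1.2⟩
    have hle := Finset.card_le_card hbd'
    have hsub : nbrs G (bd S) w ⊆ nbrs G (X \ S) w := nbrs_mono (Finset.filter_subset _ _) w
    have hsub' := Finset.card_le_card hsub
    rw [Finset.card_union_of_disjoint hdj, Finset.card_erase_of_mem hw,
      Finset.card_sdiff_of_subset hsub] at hle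
    have hpos := Finset.card_pos.mpr ⟨w, hw⟩
    rw [mul_add, mul_one] at hSe
    omega
  · intro w hw
    simp only [hbd, Finset.mem_filter, Finset.mem_sdiff] at hw
    exact hw.1.2
  · intro w hw
    simp only [hbd, Finset.mem_filter] at hw
    exact hw.2

end Sparse

end SpectralMinor

/-! ### Wheel minors in a complete bipartite pair with little extra structure. -/

namespace SpectralMinor

section OpenNecklace

variable {V : Type*} {G : SimpleGraph V} [DecidableEq V]

/-- A sequence of beads whose ends are completely joined to `A` can be extended by unused vertices
of the complete pair `A`, `R` and closed up to a wheel. -/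
lemma isMinor_wheel_of_open_necklace {k : ℕ} (hk : 3 ≤ k) (j : ℕ) (l : List (Set V))
    (A R : Finset V) (hAR : ∀ a ∈ A, ∀ r ∈ R, G.Adj a r) (hne : l ≠ [])
    (hA : j + 2 ≤ A.card) (hR : j + 1 ≤ R.card) (hlen : k ≤ l.length + 2 * j + 1)
    (hc : ∀ b ∈ l, (G.induce b).Connected)
    (hpw : l.Pairwise Disjoint) (hch : l.IsChain (SetAdj G))
    (hfull : ∀ b ∈ l, (∃ v ∈ b, ∀ a ∈ A, G.Adj a v) ∨ (∃ v ∈ b, ∀ r ∈ R, G.Adj r v))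
    (hhead : ∀ b ∈ l.head?, ∃ v ∈ b, ∀ a ∈ A, G.Adj a v)
    (hlast : ∀ b ∈ l.getLast?, ∃ v ∈ b, ∀ a ∈ A, G.Adj a v)
    (hAd : ∀ b ∈ l, ∀ v ∈ b, v ∉ A) (hRd : ∀ b ∈ l, ∀ v ∈ b, v ∉ R) :
    IsMinor (wheel k) G := by
  induction j generalizing l A R with
  | zero =>
    obtain ⟨a, ha, a₀, ha₀, haa⟩ := Finset.one_lt_card.mp (show 1 < A.card by omega)
    obtain ⟨r₀, hr₀⟩ := Finset.card_pos.mp (show 0 < R.card by omega)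
    have har : ∀ x ∈ A, x ≠ r₀ := fun x hx => (hAR x hx r₀ hr₀).ne
    -- The hub is a contracted edge between the two sides: `a₀` reaches the beads joined to `A`, and
    -- `r₀` reaches those joined to `R`. A second vertex `a` of `A` closes the cycle, which is why
    -- two vertices of `A` must be left over.
    have hS : (G.induce ({a₀} ∪ {r₀} : Set V)).Connected :=
      connected_union_of_setAdj (connected_induce_singleton _) (connected_induce_singleton _)
        ⟨a₀, rfl, r₀, rfl, hAR a₀ ha₀ r₀ hr₀⟩
    refine isMinor_wheel_of_necklace hk hS ({a} :: l) ?_ ?_ ?_ ?_ ?_ ?_ ?_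
    · simpa using hlen
    · simp only [List.mem_cons, forall_eq_or_imp]
      exact ⟨connected_induce_singleton a, hc⟩
    · rw [List.pairwise_cons]
      exact ⟨fun b hb => Set.disjoint_singleton_left.mpr fun h => hAd b hb a h ha, hpw⟩
    · rw [List.isChain_cons]
      refine ⟨fun b hb => ?_, hch⟩
      obtain ⟨v, hv, h⟩ := hhead b hb
      exact ⟨a, rfl, v, hv, h a ha⟩
    · intro z hz y hy
      rw [List.head?_cons, Option.mem_some_iff] at hy
      subst hy
      rw [List.getLast?_cons_of_ne_nil hne] at hz
      obtain ⟨v, hv, h⟩ := hlast z hz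
      exact ⟨v, hv, a, rfl, (h a ha).symm⟩
    · simp only [List.mem_cons, forall_eq_or_imp, Set.disjoint_union_left,
        Set.disjoint_singleton_left, Set.mem_singleton_iff]
      exact ⟨⟨haa.symm, (har a ha).symm⟩, fun b hb => ⟨fun h => hAd b hb _ h ha₀,
        fun h => hRd b hb _ h hr₀⟩⟩
    · simp only [List.mem_cons, forall_eq_or_imp]
      refine ⟨⟨r₀, by simp, a, rfl, (hAR a ha r₀ hr₀).symm⟩, fun b hb => ?_⟩
      rcases hfull b hb with ⟨v, hv, h⟩ | ⟨v, hv, h⟩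
      · exact ⟨a₀, by simp, v, hv, h a₀ ha₀⟩
      · exact ⟨r₀, by simp, v, hv, h r₀ hr₀⟩
  | succ j ih =>
    obtain ⟨a, ha⟩ := Finset.card_pos.mp (show 0 < A.card by omega)
    obtain ⟨r, hr⟩ := Finset.card_pos.mp (show 0 < R.card by omega)
    have hra : r ≠ a := (hAR a ha r hr).ne'
    have hrA : r ∉ A := fun h => (hAR r h r hr).ne rfl
    have haR : a ∉ R := fun h => (hAR a ha a h).ne rfl
    -- Each round spends one vertex from each side and adds two beads; the new head `{r}` is again
    -- joined to all that remains of `A`.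
    refine ih ({r} :: {a} :: l) (A.erase a) (R.erase r)
      (fun x hx y hy => hAR x (Finset.mem_of_mem_erase hx) y (Finset.mem_of_mem_erase hy))
      (by simp) (by rw [Finset.card_erase_of_mem ha]; omega)
      (by rw [Finset.card_erase_of_mem hr]; omega) (by simp only [List.length_cons]; omega)
      ?_ ?_ ?_ ?_ ?_ ?_ ?_ ?_
    · simp only [List.mem_cons, forall_eq_or_imp]
      exact ⟨connected_induce_singleton r, connected_induce_singleton a, hc⟩
    · simp only [List.pairwise_cons, List.mem_cons, forall_eq_or_imp, Set.disjoint_singleton_left,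
        Set.mem_singleton_iff]
      exact ⟨⟨hra, fun b hb h => hRd b hb r h hr⟩, fun b hb h => hAd b hb a h ha, hpw⟩
    · rw [List.isChain_cons_cons, List.isChain_cons]
      refine ⟨⟨r, rfl, a, rfl, (hAR a ha r hr).symm⟩, fun b hb => ?_, hch⟩
      obtain ⟨v, hv, h⟩ := hhead b hb
      exact ⟨a, rfl, v, hv, h a ha⟩
    · simp only [List.mem_cons, forall_eq_or_imp]
      refine ⟨Or.inl ⟨r, rfl, fun x hx => hAR x (Finset.mem_of_mem_erase hx) r hr⟩,
        Or.inr ⟨a, rfl, fun y hy => (hAR a ha y (Finset.mem_of_mem_erase hy)).symm⟩,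
        fun b hb => ?_⟩
      exact (hfull b hb).imp
        (fun ⟨v, hv, h⟩ => ⟨v, hv, fun x hx => h x (Finset.mem_of_mem_erase hx)⟩)
        (fun ⟨v, hv, h⟩ => ⟨v, hv, fun x hx => h x (Finset.mem_of_mem_erase hx)⟩)
    · intro b hb
      rw [List.head?_cons, Option.mem_some_iff] at hb
      subst hb
      exact ⟨r, rfl, fun x hx => hAR x (Finset.mem_of_mem_erase hx) r hr⟩
    · intro b hb
      rw [List.getLast?_cons_cons, List.getLast?_cons_of_ne_nil hne] at hb
      obtain ⟨v, hv, h⟩ := hlast b hb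
      exact ⟨v, hv, fun x hx => h x (Finset.mem_of_mem_erase hx)⟩
    · simp only [List.mem_cons, forall_eq_or_imp, Set.mem_singleton_iff, forall_eq,
        Finset.mem_erase, not_and]
      exact ⟨fun _ => hrA, fun h => absurd rfl h, fun b hb v hv _ => hAd b hb v hv⟩
    · simp only [List.mem_cons, forall_eq_or_imp, Set.mem_singleton_iff, forall_eq,
        Finset.mem_erase, not_and]
      exact ⟨fun h => absurd rfl h, fun _ => haR, fun b hb v hv _ => hRd b hb v hv⟩

/-- The complete bipartite graph with parts of size `g + 1` contains the wheel with cycle length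
at most `2g`. -/
lemma isMinor_wheel_of_complete_pair {k g : ℕ} (hk : 3 ≤ k) (hkg : k ≤ 2 * g) {A R : Finset V}
    (hAR : ∀ a ∈ A, ∀ r ∈ R, G.Adj a r) (hA : g + 1 ≤ A.card) (hR : g + 1 ≤ R.card) :
    IsMinor (wheel k) G := by
  obtain ⟨r, hr⟩ := Finset.card_pos.mp (show 0 < R.card by omega)
  have hfull : ∃ v ∈ ({r} : Set V), ∀ a ∈ A, G.Adj a v := ⟨r, rfl, fun a ha => hAR a ha r hr⟩
  -- The resulting cycle has `1 + 2 * (g - 1) + 1 = 2 * g` beads.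
  refine isMinor_wheel_of_open_necklace hk (g - 1) [{r}] A (R.erase r)
    (fun a ha x hx => hAR a ha x (Finset.mem_of_mem_erase hx)) (by simp) (by omega)
    (by rw [Finset.card_erase_of_mem hr]; omega) (by simp only [List.length_singleton]; omega)
    ?_ (by simp) (by simp) ?_ ?_ ?_ ?_ ?_
  · simp
  · simp only [List.mem_singleton, forall_eq]
    exact Or.inl hfull
  · simp only [List.head?_cons, Option.mem_some_iff, forall_eq']
    exact hfull
  · simp only [List.getLast?_singleton, Option.mem_some_iff, forall_eq']
    exact hfull
  · simp only [List.mem_singleton, forall_eq, Set.mem_singleton_iff]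
    exact fun h => (hAR r h r hr).ne rfl
  · simp

/-- A chain of beads that all meet `R` can be closed up with the help of the common neighbours
`R` of `L`. -/
lemma isMinor_wheel_of_segment {k g : ℕ} (hk : 3 ≤ k) (hg : 2 ≤ g) {L R U : Finset V}
    (hLR : ∀ a ∈ L, ∀ r ∈ R, G.Adj a r) (hL : g ≤ L.card) (hR : g + U.card ≤ R.card)
    (l : List (Set V)) (hne : l ≠ []) (hlen : k + 3 ≤ l.length + 2 * g)
    (hc : ∀ b ∈ l, (G.induce b).Connected)
    (hpw : l.Pairwise Disjoint) (hch : l.IsChain (SetAdj G))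
    (hmeet : ∀ b ∈ l, ∃ v ∈ b, v ∈ R) (hU : ∀ b ∈ l, ∀ v ∈ b, v ∈ U ∧ v ∉ L) :
    IsMinor (wheel k) G := by
  have hfull : ∀ b ∈ l, ∃ v ∈ b, ∀ a ∈ L, G.Adj a v := fun b hb => by
    obtain ⟨v, hv, h⟩ := hmeet b hb
    exact ⟨v, hv, fun a ha => hLR a ha v h⟩
  -- With `g` vertices in `L`, `g - 2` rounds leave the two needed at the end, so the cycle has
  -- `l.length + 2 * g - 3` beads.
  refine isMinor_wheel_of_open_necklace hk (g - 2) l L (R \ U)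
    (fun a ha x hx => hLR a ha x (Finset.mem_sdiff.mp hx).1) hne (by omega) ?_ (by omega)
    hc hpw hch (fun b hb => Or.inl (hfull b hb)) (fun b hb => hfull b (List.mem_of_mem_head? hb))
    (fun b hb => hfull b (List.mem_of_mem_getLast? hb)) (fun b hb v hv => (hU b hb v hv).2)
    (fun b hb v hv h => (Finset.mem_sdiff.mp h).2 (hU b hb v hv).1)
  have := Finset.le_card_sdiff U R
  omega

omit [DecidableEq V] in
lemma notMem_of_complete_pair {L R : Finset V} (hLR : ∀ a ∈ L, ∀ r ∈ R, G.Adj a r) {r : V}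
    (hr : r ∈ R) : r ∉ L := fun h => (hLR r h r hr).ne rfl

/-- An edge inside `R` provides two consecutive beads without spending a vertex of `L`, enough for a
cycle of length `2 * g - 1`. -/
lemma isMinor_wheel_of_edge {k g : ℕ} (hk : 3 ≤ k) (hg : 2 ≤ g) (hkg : k + 1 ≤ 2 * g)
    {L R : Finset V} (hLR : ∀ a ∈ L, ∀ r ∈ R, G.Adj a r) (hL : g ≤ L.card)
    (hR : g + 6 ≤ R.card) {r s : V} (hr : r ∈ R) (hs : s ∈ R) (hrs : G.Adj r s) :
    IsMinor (wheel k) G := by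
  refine isMinor_wheel_of_segment (U := {r, s}) hk hg hLR hL
    (by have := Finset.card_le_two (a := r) (b := s); omega) [{r}, {s}] (by simp)
    (by simp only [List.length_cons, List.length_nil]; omega) ?_ ?_ ?_ ?_ ?_
  · simp
  · simpa using hrs.ne
  · simp only [List.isChain_cons_cons, List.isChain_singleton, and_true]
    exact ⟨r, rfl, s, rfl, hrs⟩
  · simp [hr, hs]
  · simp [notMem_of_complete_pair hLR hr, notMem_of_complete_pair hLR hs]

omit [DecidableEq V] in
lemma connected_induce_pair {u v : V} (h : G.Adj u v) :
    (G.induce ({u, v} : Set V)).Connected := by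
  rw [Set.insert_eq]
  exact connected_union_of_setAdj (connected_induce_singleton _) (connected_induce_singleton _)
    ⟨u, rfl, v, rfl, h⟩

/-- Contracting `v` into `r` produces an edge inside the common neighbourhood. -/
lemma isMinor_wheel_of_cherry {k g : ℕ} (hk : 3 ≤ k) (hg : 2 ≤ g) (hkg : k + 1 ≤ 2 * g)
    {L R : Finset V} (hLR : ∀ a ∈ L, ∀ r ∈ R, G.Adj a r) (hL : g ≤ L.card)
    (hR : g + 6 ≤ R.card) {r s v : V} (hr : r ∈ R) (hs : s ∈ R) (hrs : r ≠ s) (hv : v ∉ L)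
    (hvr : G.Adj v r) (hvs : G.Adj v s) : IsMinor (wheel k) G := by
  refine isMinor_wheel_of_segment (U := {r, v, s}) hk hg hLR hL
    (by have := Finset.card_le_three (a := r) (b := v) (c := s); omega) [{r, v}, {s}] (by simp)
    (by simp only [List.length_cons, List.length_nil]; omega) ?_ ?_ ?_ ?_ ?_
  · simp [connected_induce_pair hvr.symm]
  · simp [hrs, hvs.ne]
  · simp only [List.isChain_cons_cons, List.isChain_singleton, and_true]
    exact ⟨v, by simp, s, rfl, hvs⟩
  · simp [hr, hs]
  · simp [notMem_of_complete_pair hLR hr, notMem_of_complete_pair hLR hs, hv]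

/-- Three consecutive beads in `R` gain one more, giving a cycle of length `2 * g`. -/
lemma isMinor_wheel_of_path_three {k g : ℕ} (hk : 3 ≤ k) (hg : 2 ≤ g) (hkg : k ≤ 2 * g)
    {L R : Finset V} (hLR : ∀ a ∈ L, ∀ r ∈ R, G.Adj a r) (hL : g ≤ L.card)
    (hR : g + 6 ≤ R.card) {r s v : V} (hr : r ∈ R) (hs : s ∈ R) (hrs : r ≠ s) (hv : v ∈ R)
    (hvr : G.Adj v r) (hvs : G.Adj v s) : IsMinor (wheel k) G := by
  refine isMinor_wheel_of_segment (U := {r, v, s}) hk hg hLR hL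
    (by have := Finset.card_le_three (a := r) (b := v) (c := s); omega) [{r}, {v}, {s}] (by simp)
    (by simp only [List.length_cons, List.length_nil]; omega) ?_ ?_ ?_ ?_ ?_
  · simp
  · simpa using ⟨⟨hvr.ne', hrs⟩, hvs.ne⟩
  · simp only [List.isChain_cons_cons, List.isChain_singleton, and_true]
    exact ⟨⟨r, rfl, v, rfl, hvr.symm⟩, v, rfl, s, rfl, hvs⟩
  · simp [hr, hs, hv]
  · simp [notMem_of_complete_pair hLR hr, notMem_of_complete_pair hLR hs,
      notMem_of_complete_pair hLR hv]

/-- Here `v` need not be joined to `L`; merging it with `t` yields a middle bead that meets `R`, and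
so again three consecutive beads. -/
lemma isMinor_wheel_of_claw {k g : ℕ} (hk : 3 ≤ k) (hg : 2 ≤ g) (hkg : k ≤ 2 * g)
    {L R : Finset V} (hLR : ∀ a ∈ L, ∀ r ∈ R, G.Adj a r) (hL : g ≤ L.card)
    (hR : g + 6 ≤ R.card) {r s t v : V} (hr : r ∈ R) (hs : s ∈ R) (ht : t ∈ R) (hrs : r ≠ s)
    (hrt : r ≠ t) (hst : s ≠ t) (hv : v ∉ L) (hvr : G.Adj v r) (hvs : G.Adj v s)
    (hvt : G.Adj v t) : IsMinor (wheel k) G := by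
  refine isMinor_wheel_of_segment (U := {r, v, t, s}) hk hg hLR hL
    (by have := Finset.card_le_four (a := r) (b := v) (c := t) (d := s); omega)
    [{r}, {v, t}, {s}] (by simp)
    (by simp only [List.length_cons, List.length_nil]; omega) ?_ ?_ ?_ ?_ ?_
  · simp [connected_induce_pair hvt]
  · simp [hvr.ne', hrs, hrt, hvs.ne, hst.symm]
  · simp only [List.isChain_cons_cons, List.isChain_singleton, and_true]
    exact ⟨⟨r, rfl, v, by simp, hvr.symm⟩, v, by simp, s, rfl, hvs⟩
  · simp [hr, hs, ht]
  · simp [notMem_of_complete_pair hLR hr, notMem_of_complete_pair hLR hs,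
      notMem_of_complete_pair hLR ht, hv]

/-- The two edges are linked by a vertex `a` of `L` into five beads. This leaves `g - 1` vertices in
`L` and room for `g - 3` rounds, for a cycle of length `5 + 2 * (g - 3) + 1 = 2 * g`. -/
lemma isMinor_wheel_of_two_edges {k g : ℕ} (hk : 3 ≤ k) (hg : 3 ≤ g) (hkg : k ≤ 2 * g)
    {L R : Finset V} (hLR : ∀ a ∈ L, ∀ r ∈ R, G.Adj a r) (hL : g ≤ L.card)
    (hR : g + 6 ≤ R.card) {r s t u : V} (hr : r ∈ R) (hs : s ∈ R) (ht : t ∈ R) (hu : u ∈ R)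
    (hrs : G.Adj r s) (htu : G.Adj t u) (hrt : r ≠ t) (hru : r ≠ u) (hst : s ≠ t)
    (hsu : s ≠ u) : IsMinor (wheel k) G := by
  obtain ⟨a, ha⟩ := Finset.card_pos.mp (show 0 < L.card by omega)
  have hn : ∀ x ∈ R, x ∉ L ∧ x ≠ a := fun x hx =>
    ⟨notMem_of_complete_pair hLR hx, (hLR a ha x hx).ne'⟩
  have hfull : ∀ x ∈ R, ∃ y ∈ ({x} : Set V), ∀ b ∈ L.erase a, G.Adj b y := fun x hx =>
    ⟨x, rfl, fun b hb => hLR b (Finset.mem_of_mem_erase hb) x hx⟩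
  have hcard := Finset.le_card_sdiff {r, s, t, u} R
  have hcard' := Finset.card_le_four (a := r) (b := s) (c := t) (d := u)
  refine isMinor_wheel_of_open_necklace hk (g - 3) [{r}, {s}, {a}, {t}, {u}] (L.erase a)
    (R \ {r, s, t, u})
    (fun b hb x hx => hLR b (Finset.mem_of_mem_erase hb) x (Finset.mem_sdiff.mp hx).1) (by simp)
    (by rw [Finset.card_erase_of_mem ha]; omega) (by omega)
    (by simp only [List.length_cons, List.length_nil]; omega) ?_ ?_ ?_ ?_ ?_ ?_ ?_ ?_
  · simp
  · simp [hrs.ne, htu.ne, hrt, hru, hst, hsu, (hn r hr).2, (hn s hs).2, (hn t ht).2.symm,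
      (hn u hu).2.symm]
  · simp only [List.isChain_cons_cons, List.isChain_singleton, and_true]
    exact ⟨⟨r, rfl, s, rfl, hrs⟩, ⟨s, rfl, a, rfl, (hLR a ha s hs).symm⟩,
      ⟨a, rfl, t, rfl, hLR a ha t ht⟩, ⟨t, rfl, u, rfl, htu⟩⟩
  · simp only [List.mem_cons, forall_eq_or_imp, List.not_mem_nil, false_imp_iff, implies_true,
      and_true]
    exact ⟨Or.inl (hfull r hr), Or.inl (hfull s hs),
      Or.inr ⟨a, rfl, fun x hx => (hLR a ha x (Finset.mem_sdiff.mp hx).1).symm⟩,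
      Or.inl (hfull t ht), Or.inl (hfull u hu)⟩
  · simp only [List.head?_cons, Option.mem_some_iff, forall_eq']
    exact hfull r hr
  · simp only [List.getLast?_cons_cons, List.getLast?_singleton, Option.mem_some_iff, forall_eq']
    exact hfull u hu
  · simp [(hn r hr).1, (hn s hs).1, (hn t ht).1, (hn u hu).1]
  · have : a ∉ R := fun h => (hLR a ha a h).ne rfl
    simp [this]

end OpenNecklace

end SpectralMinor

/-! ### Books have no wheel minor. -/

namespace SpectralMinor

/-- If deleting a set of at most `g` vertices leaves few edges, there is no wheel minor. -/
lemma not_isMinor_wheel {V : Type*} {G : SimpleGraph V} {k g : ℕ} (hk : 3 ≤ k) (hg : 2 ≤ g)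
    {L : Finset V} {F : Finset (Sym2 V)} (hL : L.card ≤ g) (hF : F.card + 2 * g ≤ k + 1)
    (hedge : ∀ u v, u ∉ L → v ∉ L → G.Adj u v → s(u, v) ∈ F) : ¬ IsMinor (wheel k) G := by
  classical
  rintro ⟨B, -, hdisj, hadj⟩
  obtain ⟨m, rfl⟩ : ∃ m, k = m + 3 := ⟨k - 3, by omega⟩
  have : Nonempty V := by
    obtain ⟨u, -⟩ := hadj (.inl 0) (.inr 0) (wheel_adj_inl_inr _ _)
    exact ⟨u⟩
  have huniq : ∀ {x y v}, v ∈ B x → v ∈ B y → x = y := by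
    intro x y v hx hy
    by_contra h
    exact Set.disjoint_left.mp (hdisj x y h) hx hy
  set I : Finset (Fin (m + 3)) := Finset.univ.filter fun i => ∀ v ∈ B (.inr i), v ∉ L with hI
  have hI' : ∀ i, i ∈ I ↔ ∀ v ∈ B (.inr i), v ∉ L := fun i => by simp [hI]
  set M : Finset (Fin 1 ⊕ Fin (m + 3)) := Finset.univ.filter fun x => ∃ v ∈ B x, v ∈ L with hM
  have hMcard : M.card ≤ g := by
    refine le_trans ?_ hL
    have h : ∀ x ∈ M, ∃ v ∈ B x, v ∈ L := fun x hx => (Finset.mem_filter.mp hx).2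
    choose! f hf hfL using h
    exact Finset.card_le_card_of_injOn f (fun x hx => hfL x hx)
      (fun x hx y hy hxy => huniq (hf x hx) (hxy ▸ hf y hy))
  have hIc : (Iᶜ).image Sum.inr ⊆ M := by
    intro x hx
    obtain ⟨i, hi, rfl⟩ := Finset.mem_image.mp hx
    rw [Finset.mem_compl, hI'] at hi
    push Not at hi
    simpa [hM] using hi
  have hIcard : (Iᶜ).card = m + 3 - I.card := by
    rw [Finset.card_compl, Fintype.card_fin]
  have hIle : I.card ≤ m + 3 := by
    simpa using Finset.card_le_univ I
  -- If the hub meets `L`, at most `g - 1` rim sets do, so at least `k - 2 * g + 2` cyclically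
  -- consecutive pairs of rim sets avoid `L`, each needing its own edge of `F`. Otherwise at least
  -- `k - g` rim sets avoid `L`, each needing an edge of `F` to the hub; that is too many because `g
  -- ≥ 2`.
  by_cases hub : ∃ v ∈ B (.inl 0), v ∈ L
  · have h1 : (Iᶜ).card + 1 ≤ M.card := by
      rw [← Finset.card_image_of_injective (Iᶜ) (Sum.inr_injective (α := Fin 1)),
        ← Finset.card_insert_of_notMem (a := Sum.inl (0 : Fin 1)) (by simp)]
      exact Finset.card_le_card (Finset.insert_subset (by simpa [hM] using hub) hIc)
    set I' : Finset (Fin (m + 3)) := Finset.univ.filter fun i => i + 1 ∈ I with hI'def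
    have hcard' : I'.card = I.card :=
      Finset.card_equiv (Equiv.addRight 1) (fun i => by simp [hI'def])
    have h2 := Finset.card_union_add_card_inter I I'
    have h3 : (I ∪ I').card ≤ m + 3 := by simpa using Finset.card_le_univ (I ∪ I')
    have h4 : (I ∩ I').card ≤ F.card := by
      have h : ∀ i ∈ I ∩ I', ∃ p : V × V, p.1 ∈ B (.inr i) ∧ p.2 ∈ B (.inr (i + 1)) ∧
          s(p.1, p.2) ∈ F := by
        intro i hi
        have hi₁ := (hI' i).mp (Finset.mem_inter.mp hi).1
        have hi₂ := (hI' (i + 1)).mp (by simpa [hI'def] using (Finset.mem_inter.mp hi).2)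
        obtain ⟨u, hu, v, hv, huv⟩ := hadj (.inr i) (.inr (i + 1)) (by
          rw [wheel_adj_inr_inr, SimpleGraph.cycleGraph_adj']
          right
          simp)
        exact ⟨(u, v), hu, hv, hedge u v (hi₁ u hu) (hi₂ v hv) huv⟩
      choose! p hp1 hp2 hpF using h
      refine Finset.card_le_card_of_injOn (fun i => s((p i).1, (p i).2)) (fun i hi => hpF i hi) ?_
      intro i hi j hj hij
      dsimp only at hij
      rw [Sym2.eq_iff] at hij
      rcases hij with ⟨h, -⟩ | ⟨h, h'⟩
      · exact Sum.inr_injective (huniq (hp1 i hi) (h ▸ hp1 j hj))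
      -- One edge read in opposite directions would give `i = j + 1` and `j = i + 1`, impossible on
      -- a cycle of length at least three.
      · have e1 := Sum.inr_injective (huniq (hp1 i hi) (h ▸ hp2 j hj))
        have e2 := Sum.inr_injective (huniq (hp2 i hi) (h' ▸ hp1 j hj))
        exfalso
        rw [← e2, add_assoc] at e1
        have e3 : (1 : Fin (m + 3)) + 1 = 0 := left_eq_add.mp e1
        have := congrArg Fin.val e3
        rw [Fin.val_add, Fin.val_one, Fin.val_zero, Nat.mod_eq_of_lt (by omega)] at this
        omega
    omega
  · push Not at hub
    have h1 : (Iᶜ).card ≤ M.card := by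
      rw [← Finset.card_image_of_injective (Iᶜ) (Sum.inr_injective (α := Fin 1))]
      exact Finset.card_le_card hIc
    have h4 : I.card ≤ F.card := by
      have h : ∀ i ∈ I, ∃ p : V × V, p.1 ∈ B (.inl 0) ∧ p.2 ∈ B (.inr i) ∧
          s(p.1, p.2) ∈ F := by
        intro i hi
        rw [hI'] at hi
        obtain ⟨u, hu, v, hv, huv⟩ := hadj (.inl 0) (.inr i) (wheel_adj_inl_inr _ _)
        exact ⟨(u, v), hu, hv, hedge u v (hub u hu) (hi v hv) huv⟩
      choose! p hp1 hp2 hpF using h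
      refine Finset.card_le_card_of_injOn (fun i => s((p i).1, (p i).2)) (fun i hi => hpF i hi) ?_
      intro i hi j hj hij
      dsimp only at hij
      rw [Sym2.eq_iff] at hij
      rcases hij with ⟨-, h⟩ | ⟨h, h'⟩
      · exact Sum.inr_injective (huniq (hp2 i hi) (h ▸ hp2 j hj))
      · exact absurd (huniq (hp1 i hi) (h ▸ hp2 j hj)) Sum.inl_ne_inr
    omega

end SpectralMinor

/-! ### The Rayleigh quotient and the spectral radius. -/

namespace SpectralMinor

open Classical in
/-- The quadratic form of the adjacency matrix. -/
noncomputable def adjForm {V : Type*} [Fintype V] (G : SimpleGraph V) (x : V → ℝ) : ℝ :=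
  ∑ u, ∑ v, if G.Adj u v then x u * x v else 0

section Spectral

variable {V : Type*} [Fintype V] {G : SimpleGraph V}

lemma adjForm_eq_sum_nbrs (x : V → ℝ) :
    adjForm G x = ∑ v, x v * ∑ u ∈ nbrs G Finset.univ v, x u := by
  classical
  refine Finset.sum_congr rfl fun v _ => ?_
  rw [nbrs, Finset.sum_filter, Finset.mul_sum]
  exact Finset.sum_congr rfl fun u _ => by split_ifs <;> simp

open Classical in
lemma adjMatrix_mulVec_eq (x : V → ℝ) (v : V) :
    (G.adjMatrix ℝ).mulVec x v = ∑ u ∈ nbrs G Finset.univ v, x u := by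
  rw [SimpleGraph.adjMatrix_mulVec_apply]
  refine Finset.sum_congr ?_ fun _ _ => rfl
  ext u
  simp [mem_nbrs]

open Classical in
lemma dotProduct_adjMatrix_mulVec (x : V → ℝ) :
    x ⬝ᵥ (G.adjMatrix ℝ).mulVec x = adjForm G x := by
  rw [adjForm_eq_sum_nbrs]
  exact Finset.sum_congr rfl fun v _ => by rw [adjMatrix_mulVec_eq]

lemma continuous_adjForm : Continuous (adjForm G) := by
  classical
  unfold adjForm
  refine continuous_finsetSum _ fun u _ => continuous_finsetSum _ fun v _ => ?_
  split_ifs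
  · fun_prop
  · fun_prop

lemma adjForm_smul (c : ℝ) (x : V → ℝ) : adjForm G (fun v => c * x v) = c ^ 2 * adjForm G x := by
  classical
  unfold adjForm
  rw [Finset.mul_sum]
  refine Finset.sum_congr rfl fun u _ => ?_
  rw [Finset.mul_sum]
  refine Finset.sum_congr rfl fun v _ => ?_
  split_ifs <;> ring

lemma abs_adjForm_le (x : V → ℝ) : |adjForm G x| ≤ adjForm G (fun v => |x v|) := by
  classical
  unfold adjForm
  refine (Finset.abs_sum_le_sum_abs _ _).trans (Finset.sum_le_sum fun u _ => ?_)
  refine (Finset.abs_sum_le_sum_abs _ _).trans (Finset.sum_le_sum fun v _ => ?_)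
  split_ifs
  · rw [abs_mul]
  · simp

/-- The maximum `ρ` of the Rayleigh quotient is attained at a nonnegative vector. -/
lemma exists_max_rayleigh [Nonempty V] (G : SimpleGraph V) :
    ∃ (ρ : ℝ) (x : V → ℝ), (∀ y, adjForm G y ≤ ρ * ∑ v, y v ^ 2) ∧ (∀ v, 0 ≤ x v) ∧ x ≠ 0 ∧
      adjForm G x = ρ * ∑ v, x v ^ 2 := by
  classical
  set K : Set (V → ℝ) := {x | ∑ v, x v ^ 2 = 1} with hK
  have hKc : IsCompact K := by
    refine Metric.isCompact_of_isClosed_isBounded ?_ ?_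
    · exact isClosed_eq (by fun_prop) continuous_const
    · refine (Metric.isBounded_iff_subset_closedBall 0).mpr ⟨1, fun x hx => ?_⟩
      rw [mem_closedBall_zero_iff, pi_norm_le_iff_of_nonneg zero_le_one]
      intro v
      have h1 : x v ^ 2 ≤ 1 := by
        rw [← (show ∑ v, x v ^ 2 = 1 from hx)]
        exact Finset.single_le_sum (f := fun v => x v ^ 2) (fun _ _ => sq_nonneg _)
          (Finset.mem_univ v)
      exact abs_le_one_iff_mul_self_le_one.mpr (by nlinarith)
  have hKne : K.Nonempty := by
    obtain ⟨w⟩ := (inferInstance : Nonempty V)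
    exact ⟨Pi.single w 1, by simp [hK, Pi.single_apply]⟩
  obtain ⟨x, hx, hmax⟩ := hKc.exists_isMaxOn hKne (continuous_adjForm (G := G)).continuousOn
  have hmax' : ∀ y ∈ K, adjForm G y ≤ adjForm G x := fun y hy => hmax hy
  -- Taking absolute values preserves the norm and does not decrease the form, so a maximizer may be
  -- taken nonnegative.
  have habs : (fun v => |x v|) ∈ K := by
    simpa [hK] using hx
  have hxx : ∑ v, |x v| ^ 2 = 1 := habs
  refine ⟨adjForm G x, fun v => |x v|, fun y => ?_, fun v => abs_nonneg _, ?_, ?_⟩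
  · set s := ∑ v, y v ^ 2 with hs
    have hs0 : 0 ≤ s := Finset.sum_nonneg fun _ _ => sq_nonneg _
    rcases hs0.eq_or_lt with h0 | h0
    · have hy : ∀ v, y v = 0 := by
        intro v
        have := (Finset.sum_eq_zero_iff_of_nonneg (fun v _ => sq_nonneg (y v))).mp h0.symm v
          (Finset.mem_univ v)
        exact pow_eq_zero_iff two_ne_zero |>.mp this
      rw [← h0, mul_zero]
      simp [adjForm, hy]
    · have hsq : (Real.sqrt s)⁻¹ ^ 2 = s⁻¹ := by rw [inv_pow, Real.sq_sqrt hs0]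
      have hmem : (fun v => (Real.sqrt s)⁻¹ * y v) ∈ K := by
        simp only [hK, Set.mem_ofPred_eq, mul_pow, ← Finset.mul_sum, hsq, ← hs]
        exact inv_mul_cancel₀ h0.ne'
      have := hmax' _ hmem
      rw [adjForm_smul, hsq, inv_mul_le_iff₀ h0] at this
      linarith
  · intro h
    have : ∑ v, |x v| ^ 2 = 0 := by
      refine Finset.sum_eq_zero fun v _ => ?_
      rw [show |x v| = 0 from congrFun h v]
      simp
    linarith
  · rw [hxx, mul_one]
    exact le_antisymm (hmax' _ habs) ((le_abs_self _).trans (abs_adjForm_le x))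

/-- A vector attaining the maximum of the Rayleigh quotient is an eigenvector. -/
lemma sum_nbrs_eq_of_max {ρ : ℝ} (hρ : ∀ y, adjForm G y ≤ ρ * ∑ v, y v ^ 2) {x : V → ℝ}
    (hx : adjForm G x = ρ * ∑ v, x v ^ 2) (v : V) :
    ∑ u ∈ nbrs G Finset.univ v, x u = ρ * x v := by
  classical
  set A := G.adjMatrix ℝ with hA
  have hform : ∀ y : V → ℝ, y ⬝ᵥ (ρ • (1 : Matrix V V ℝ) - A).mulVec y =
      ρ * ∑ v, y v ^ 2 - adjForm G y := by
    intro y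
    rw [Matrix.sub_mulVec, dotProduct_sub, dotProduct_adjMatrix_mulVec, Matrix.smul_mulVec,
      Matrix.one_mulVec, dotProduct_smul, smul_eq_mul, dotProduct]
    simp only [pow_two]
  -- A vector on which a positive semidefinite form vanishes lies in the kernel of its matrix.
  have hpsd : (ρ • (1 : Matrix V V ℝ) - A).PosSemidef := by
    refine Matrix.PosSemidef.of_dotProduct_mulVec_nonneg ?_ fun y => ?_
    · have h1 : (ρ • (1 : Matrix V V ℝ)).IsHermitian := by
        simp [Matrix.IsHermitian]
      have h2 : A.IsHermitian := by
        rw [Matrix.IsHermitian, Matrix.conjTranspose_eq_transpose_of_trivial]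
        exact G.transpose_adjMatrix
      exact h1.sub h2
    · rw [star_trivial, hform]
      linarith [hρ y]
  have h0 := (hpsd.dotProduct_mulVec_zero_iff x).mp (by rw [star_trivial, hform, hx, sub_self])
  have := congrFun h0 v
  rw [Matrix.sub_mulVec, Matrix.smul_mulVec, Matrix.one_mulVec, Pi.sub_apply,
    adjMatrix_mulVec_eq, Pi.smul_apply, smul_eq_mul, Pi.zero_apply] at this
  linarith

/-- The maximum `ρ` is an eigenvalue, and it dominates negative eigenvalues too: the form at `y` is
bounded in absolute value by the form at `|y|`. -/
lemma graphSpectralRadius_eq [DecidableEq V] {ρ : ℝ}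
    (hρ : ∀ y, adjForm G y ≤ ρ * ∑ v, y v ^ 2) {x : V → ℝ} (hx0 : x ≠ 0)
    (hx : adjForm G x = ρ * ∑ v, x v ^ 2) : graphSpectralRadius G = ENNReal.ofReal ρ := by
  classical
  have hmem : ∀ μ : ℝ, μ ∈ spectrum ℝ (G.adjMatrix ℝ) ↔
      ∃ y : V → ℝ, y ≠ 0 ∧ ∀ v, ∑ u ∈ nbrs G Finset.univ v, y u = μ * y v := by
    intro μ
    rw [← Matrix.spectrum_toLin', ← Module.End.hasEigenvalue_iff_mem_spectrum]
    constructor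
    · intro h
      obtain ⟨y, hy⟩ := h.exists_hasEigenvector
      refine ⟨y, hy.2, fun v => ?_⟩
      have := congrFun hy.apply_eq_smul v
      rw [Matrix.toLin'_apply, adjMatrix_mulVec_eq] at this
      simpa using this
    · rintro ⟨y, hy, h⟩
      refine Module.End.hasEigenvalue_of_hasEigenvector (x := y) ⟨?_, hy⟩
      rw [Module.End.mem_eigenspace_iff, Matrix.toLin'_apply]
      funext v
      rw [adjMatrix_mulVec_eq, h]
      simp
  have hpos : ∀ y : V → ℝ, y ≠ 0 → 0 < ∑ v, y v ^ 2 := by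
    intro y hy
    obtain ⟨v, hv⟩ := Function.ne_iff.mp hy
    exact Finset.sum_pos' (fun _ _ => sq_nonneg _)
      ⟨v, Finset.mem_univ v, lt_of_le_of_ne (sq_nonneg _) (Ne.symm (pow_ne_zero 2 hv))⟩
  have habs : ∀ μ ∈ spectrum ℝ (G.adjMatrix ℝ), |μ| ≤ ρ := by
    intro μ hμ
    obtain ⟨y, hy, h⟩ := (hmem μ).mp hμ
    have h1 : adjForm G y = μ * ∑ v, y v ^ 2 := by
      rw [adjForm_eq_sum_nbrs, Finset.mul_sum]
      exact Finset.sum_congr rfl fun v _ => by rw [h]; ring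
    have h2 := (abs_adjForm_le (G := G) y).trans (hρ _)
    simp only [sq_abs] at h2
    rw [h1, abs_mul, abs_of_pos (hpos y hy)] at h2
    exact le_of_mul_le_mul_right h2 (hpos y hy)
  have hρmem : ρ ∈ spectrum ℝ (G.adjMatrix ℝ) :=
    (hmem ρ).mpr ⟨x, hx0, sum_nbrs_eq_of_max hρ hx⟩
  have hρ0 : 0 ≤ ρ := (abs_nonneg ρ).trans (habs ρ hρmem)
  have hcoe : ∀ μ : ℝ, (‖μ‖₊ : ENNReal) = ENNReal.ofReal |μ| := by
    intro μ
    rw [← Real.norm_eq_abs, ofReal_norm]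
    rfl
  unfold graphSpectralRadius spectralRadius
  refine le_antisymm (iSup₂_le fun μ hμ => ?_) ?_
  · rw [hcoe]
    exact ENNReal.ofReal_le_ofReal (habs μ hμ)
  · refine le_trans ?_ (le_iSup₂ (f := fun (μ : ℝ) (_ : μ ∈ spectrum ℝ (G.adjMatrix ℝ)) =>
      (‖μ‖₊ : ENNReal)) ρ hρmem)
    rw [hcoe, abs_of_nonneg hρ0]

lemma adjForm_iso {W : Type*} [Fintype W] {H : SimpleGraph W} (e : G ≃g H) (y : W → ℝ) :
    adjForm G (fun v => y (e v)) = adjForm H y := by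
  classical
  unfold adjForm
  rw [← e.toEquiv.sum_comp]
  refine Finset.sum_congr rfl fun u _ => ?_
  rw [← e.toEquiv.sum_comp]
  refine Finset.sum_congr rfl fun v _ => ?_
  simp [SimpleGraph.Iso.map_adj_iff]

lemma graphSpectralRadius_iso [DecidableEq V] {W : Type*} [Fintype W] [DecidableEq W] [Nonempty W]
    {H : SimpleGraph W} (e : G ≃g H) : graphSpectralRadius G = graphSpectralRadius H := by
  obtain ⟨ρ, x, h1, -, h3, h4⟩ := exists_max_rayleigh H
  rw [graphSpectralRadius_eq h1 h3 h4]
  have hsum : ∀ y : W → ℝ, ∑ v, y (e v) ^ 2 = ∑ w, y w ^ 2 :=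
    fun y => e.toEquiv.sum_comp fun w => y w ^ 2
  refine graphSpectralRadius_eq (x := fun v => x (e v)) (fun y => ?_) ?_ ?_
  · have := h1 (fun w => y (e.symm w))
    rw [← adjForm_iso e, ← hsum] at this
    simpa using this
  · intro h
    apply h3
    funext w
    simpa using congrFun h (e.symm w)
  · rw [adjForm_iso e, hsum, h4]

end Spectral

lemma IsMinor.of_iso {W V V' : Type*} {H : SimpleGraph W} {G : SimpleGraph V}
    {G' : SimpleGraph V'} (e : G ≃g G') (h : IsMinor H G) : IsMinor H G' := by
  obtain ⟨B, h1, h2, h3⟩ := h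
  refine ⟨fun x => e '' B x, fun x => ?_, fun x y hxy => ?_, fun x y hxy => ?_⟩
  · have f : G.induce (B x) ≃g G'.induce (e '' B x) :=
      ⟨e.toEquiv.image (B x), by
        rintro ⟨a, ha⟩ ⟨b, hb⟩
        exact e.map_adj_iff⟩
    exact f.connected_iff.mp (h1 x)
  · exact (Set.disjoint_image_iff e.injective).mpr (h2 x y hxy)
  · obtain ⟨u, hu, v, hv, huv⟩ := h3 x y hxy
    exact ⟨e u, ⟨u, hu, rfl⟩, e v, ⟨v, hv, rfl⟩, e.map_adj_iff.mpr huv⟩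

end SpectralMinor

/-! ### Concentration of the eigenvector on `g` vertices. -/

namespace SpectralMinor

section Sums

variable {V : Type*} [DecidableEq V] {G : SimpleGraph V}

/-- In a sparse graph the quadratic form of a vector with small entries is small. -/
lemma sum_sum_adj_le {D : ℕ} (hD : ∀ X : Finset V, ∑ v ∈ X, (nbrs G X v).card ≤ D * X.card)
    {x : V → ℝ} (hx : ∀ v, 0 ≤ x v) {δ : ℝ} (X : Finset V) (hδ : ∀ v ∈ X, x v ≤ δ) :
    ∑ u ∈ X, x u * ∑ v ∈ nbrs G X u, x v ≤ 2 * D * δ * ∑ v ∈ X, x v := by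
  induction hm : X.card generalizing X with
  | zero =>
    rw [Finset.card_eq_zero] at hm
    simp [hm]
  | succ m ih =>
    have hne : X.Nonempty := Finset.card_pos.mp (by omega)
    -- Sparsity gives a vertex of degree at most `D`. Removing it costs its edges counted in both
    -- directions, hence the factor two.
    obtain ⟨w, hw, hwD⟩ : ∃ w ∈ X, (nbrs G X w).card ≤ D := by
      refine Finset.exists_le_of_sum_le (g := fun _ => D) hne ?_
      simpa [mul_comm] using hD X
    have hrec := ih (X.erase w) (fun v hv => hδ v (Finset.mem_of_mem_erase hv))
      (by rw [Finset.card_erase_of_mem hw]; omega)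
    have h1 : ∀ u ∈ X.erase w, x u * ∑ v ∈ nbrs G X u, x v =
        x u * ∑ v ∈ nbrs G (X.erase w) u, x v + if u ∈ nbrs G X w then x w * x u else 0 := by
      intro u hu
      have he : nbrs G (X.erase w) u = (nbrs G X u).erase w := by
        ext z
        simp only [mem_nbrs, Finset.mem_erase]
        tauto
      rw [he]
      split_ifs with h
      · rw [← Finset.add_sum_erase (nbrs G X u) x
          (mem_nbrs.mpr ⟨hw, (mem_nbrs.mp h).2.symm⟩)]
        ring
      · rw [Finset.erase_eq_of_notMem fun h' => h (mem_nbrs.mpr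
          ⟨Finset.mem_of_mem_erase hu, (mem_nbrs.mp h').2.symm⟩), add_zero]
    have h2 : ∑ u ∈ X.erase w, (if u ∈ nbrs G X w then x w * x u else 0) =
        x w * ∑ u ∈ nbrs G X w, x u := by
      rw [← Finset.sum_filter, Finset.mul_sum]
      refine Finset.sum_congr ?_ fun _ _ => rfl
      ext u
      simp only [Finset.mem_filter, Finset.mem_erase, mem_nbrs]
      exact ⟨fun h => h.2, fun h => ⟨⟨h.2.ne', h.1⟩, h⟩⟩
    have h3 : ∑ u ∈ nbrs G X w, x u ≤ D * δ := by
      calc ∑ u ∈ nbrs G X w, x u ≤ (nbrs G X w).card • δ :=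
            Finset.sum_le_card_nsmul _ _ _ fun u hu => hδ u (nbrs_subset X w hu)
        _ ≤ D * δ := by
            rw [nsmul_eq_mul]
            exact mul_le_mul_of_nonneg_right (by exact_mod_cast hwD)
              ((hx w).trans (hδ w hw))
    rw [← Finset.add_sum_erase _ _ hw, Finset.sum_congr rfl h1, Finset.sum_add_distrib, h2,
      ← Finset.add_sum_erase X x hw]
    nlinarith [mul_le_mul_of_nonneg_left h3 (hx w)]

/-- Few pairs run between a set and another one in a sparse graph. -/
lemma sum_card_nbrs_le {D : ℕ}
    (hD : ∀ X : Finset V, ∑ v ∈ X, (nbrs G X v).card ≤ D * X.card) (X L : Finset V) :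
    ∑ w ∈ X, (nbrs G L w).card ≤ D * (X.card + L.card) := by
  calc ∑ w ∈ X, (nbrs G L w).card ≤ ∑ w ∈ X, (nbrs G (X ∪ L) w).card :=
        Finset.sum_le_sum fun w _ =>
          Finset.card_le_card (nbrs_mono Finset.subset_union_right w)
    _ ≤ ∑ w ∈ X ∪ L, (nbrs G (X ∪ L) w).card :=
        Finset.sum_le_sum_of_subset Finset.subset_union_left
    _ ≤ D * (X ∪ L).card := hD _
    _ ≤ D * (X.card + L.card) := Nat.mul_le_mul_left _ (Finset.card_union_le _ _)

end Sums

/-- A nonnegative eigenvector, with entries at most one, of a sparse graph whose spectral radius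
is at least that of the complete bipartite graph with parts of size `g` and `n - g`. -/
structure SparseEigenvector {V : Type*} [Fintype V] (G : SimpleGraph V) (D g : ℕ) (ρ : ℝ)
    (x : V → ℝ) : Prop where
  sparse : ∀ X : Finset V, ∑ v ∈ X, (nbrs G X v).card ≤ D * X.card
  nonneg : ∀ v, 0 ≤ x v
  le_one : ∀ v, x v ≤ 1
  eig : ∀ v, ∑ u ∈ nbrs G Finset.univ v, x u = ρ * x v
  rho_nonneg : 0 ≤ ρ
  rho_sq : (g : ℝ) * (Fintype.card V - g) ≤ ρ ^ 2

namespace SparseEigenvector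

variable {V : Type*} [Fintype V] [DecidableEq V] {G : SimpleGraph V} {D g : ℕ} {ρ : ℝ}
  {x : V → ℝ}

/-- The vertices whose entry is at least `η`. -/
noncomputable def large (x : V → ℝ) (η : ℝ) : Finset V := Finset.univ.filter fun v => η ≤ x v

omit [DecidableEq V] in
lemma mem_large {η : ℝ} {v : V} : v ∈ large x η ↔ η ≤ x v := by simp [large]

omit [DecidableEq V] in
lemma sum_degree_le (h : SparseEigenvector G D g ρ x) :
    ∑ v, ((nbrs G Finset.univ v).card : ℝ) ≤ D * Fintype.card V := by
  have := h.sparse Finset.univ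
  rw [Finset.card_univ] at this
  exact_mod_cast this

omit [DecidableEq V] in
lemma rho_mul_le_degree (h : SparseEigenvector G D g ρ x) (v : V) :
    ρ * x v ≤ (nbrs G Finset.univ v).card := by
  rw [← h.eig]
  calc ∑ u ∈ nbrs G Finset.univ v, x u ≤ (nbrs G Finset.univ v).card • (1 : ℝ) :=
        Finset.sum_le_card_nsmul _ _ _ fun u _ => h.le_one u
    _ = _ := by simp

-- Markov's inequality for degrees, whose sum is at most `D` times the order.
omit [DecidableEq V] in
lemma card_large_mul_le (h : SparseEigenvector G D g ρ x) (η c : ℝ)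
    (hc : ∀ v ∈ large x η, c ≤ (nbrs G Finset.univ v).card) :
    (large x η).card * c ≤ D * Fintype.card V := by
  refine le_trans ?_ h.sum_degree_le
  calc ((large x η).card : ℝ) * c = ∑ v ∈ large x η, c := by simp
    _ ≤ ∑ v ∈ large x η, ((nbrs G Finset.univ v).card : ℝ) := Finset.sum_le_sum hc
    _ ≤ ∑ v, ((nbrs G Finset.univ v).card : ℝ) :=
        Finset.sum_le_sum_of_subset_of_nonneg (Finset.subset_univ _) fun _ _ _ => by positivity

/-- Walks of length two from `v`, split according to whether they end at a large entry. -/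
lemma rho_sq_mul_le (h : SparseEigenvector G D g ρ x) {η : ℝ} (hη : 0 ≤ η) (v : V) :
    ρ ^ 2 * x v ≤ η * D * Fintype.card V +
      ∑ w ∈ nbrs G Finset.univ v, ∑ u ∈ nbrs G (large x η) w, x u := by
  have h1 : ∀ w, ∑ u ∈ nbrs G Finset.univ w, x u ≤
      η * (nbrs G Finset.univ w).card + ∑ u ∈ nbrs G (large x η) w, x u := by
    intro w
    have hsub : nbrs G (large x η) w ⊆ nbrs G Finset.univ w := nbrs_mono (Finset.subset_univ _) w
    rw [← Finset.sum_sdiff hsub]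
    refine add_le_add_left ?_ _
    calc ∑ u ∈ nbrs G Finset.univ w \ nbrs G (large x η) w, x u
        ≤ (nbrs G Finset.univ w \ nbrs G (large x η) w).card • η := by
          refine Finset.sum_le_card_nsmul _ _ _ fun u hu => ?_
          rw [Finset.mem_sdiff, mem_nbrs, mem_nbrs, mem_large] at hu
          by_contra! hlt
          exact hu.2 ⟨hlt.le, hu.1.2⟩
      _ ≤ η * (nbrs G Finset.univ w).card := by
          rw [nsmul_eq_mul, mul_comm]
          exact mul_le_mul_of_nonneg_left
            (by exact_mod_cast Finset.card_le_card Finset.sdiff_subset) hη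
  calc ρ ^ 2 * x v = ∑ w ∈ nbrs G Finset.univ v, ∑ u ∈ nbrs G Finset.univ w, x u := by
        simp_rw [h.eig, ← Finset.mul_sum, h.eig]
        ring
    _ ≤ ∑ w ∈ nbrs G Finset.univ v, (η * (nbrs G Finset.univ w).card +
          ∑ u ∈ nbrs G (large x η) w, x u) := Finset.sum_le_sum fun w _ => h1 w
    _ ≤ _ := by
        rw [Finset.sum_add_distrib, ← Finset.mul_sum, mul_assoc η]
        refine add_le_add_left (mul_le_mul_of_nonneg_left (le_trans ?_ h.sum_degree_le) hη) _
        exact Finset.sum_le_sum_of_subset_of_nonneg (Finset.subset_univ _)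
          fun _ _ _ => by positivity

omit [DecidableEq V] in
lemma sum_nbrs_le_card (h : SparseEigenvector G D g ρ x) (L : Finset V) (w : V) :
    ∑ u ∈ nbrs G L w, x u ≤ (nbrs G L w).card := by
  calc ∑ u ∈ nbrs G L w, x u ≤ (nbrs G L w).card • (1 : ℝ) :=
        Finset.sum_le_card_nsmul _ _ _ fun u _ => h.le_one u
    _ = _ := by simp

/-- The edges between the neighbourhood of `v` and the large vertices are bounded by sparsity, so a
large entry forces a large degree. -/
lemma rho_sq_mul_le_degree (h : SparseEigenvector G D g ρ x) {η : ℝ} (hη : 0 ≤ η) (v : V) :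
    ρ ^ 2 * x v ≤ η * D * Fintype.card V +
      D * ((nbrs G Finset.univ v).card + (large x η).card) := by
  refine (h.rho_sq_mul_le hη v).trans (add_le_add_right ?_ _)
  calc ∑ w ∈ nbrs G Finset.univ v, ∑ u ∈ nbrs G (large x η) w, x u
      ≤ ∑ w ∈ nbrs G Finset.univ v, ((nbrs G (large x η) w).card : ℝ) :=
        Finset.sum_le_sum fun w _ => h.sum_nbrs_le_card _ w
    _ ≤ _ := by exact_mod_cast sum_card_nbrs_le h.sparse _ _

/-- For every threshold the number of large entries is bounded independently of the order of the
graph. -/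
lemma exists_card_large_le (D g : ℕ) (hD : 1 ≤ D) (hg : 1 ≤ g) {η : ℝ} (hη : 0 < η) :
    ∃ N K : ℕ, ∀ {V : Type} [Fintype V] [DecidableEq V] {G : SimpleGraph V} {ρ : ℝ} {x : V → ℝ},
      SparseEigenvector G D g ρ x → N ≤ Fintype.card V → (large x η).card ≤ K := by
  have hD' : (1 : ℝ) ≤ D := by exact_mod_cast hD
  have hg' : (1 : ℝ) ≤ g := by exact_mod_cast hg
  -- The bound is bootstrapped. Degrees of at least `ρ * θ` leave only `O(√n)` entries above the
  -- auxiliary threshold `θ`. Inserting this into the walk estimate shows that entries above `η`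
  -- have degree linear in `n`, so there are boundedly many. `θ` makes the small-entry term `g * η *
  -- n / 4`, and `P` makes the other error `g * η * n / 8`.
  set θ : ℝ := g * η / (4 * D) with hθ
  have hθ0 : 0 < θ := by positivity
  set P : ℝ := 8 * D * D / (g * η * θ) with hP
  have hP0 : 0 < P := by positivity
  obtain ⟨N, hN⟩ := exists_nat_ge (P ^ 2 + 8 * g + 1)
  obtain ⟨K, hK⟩ := exists_nat_ge (2 * D * D / (g * η) : ℝ)
  refine ⟨N, K, fun {V} _ _ {G ρ x} h hV => ?_⟩
  set n : ℝ := (Fintype.card V : ℝ) with hn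
  have hNn : (N : ℝ) ≤ n := by rw [hn]; exact_mod_cast hV
  have hn0 : 0 < n := by nlinarith [sq_nonneg P]
  have hρP : P ≤ ρ := by
    refine le_of_sq_le_sq ?_ h.rho_nonneg
    refine le_trans ?_ h.rho_sq
    nlinarith [sq_nonneg P]
  have hsmall : (large x θ).card * (θ * ρ) ≤ D * n := by
    refine h.card_large_mul_le θ _ fun v hv => le_trans ?_ (h.rho_mul_le_degree v)
    rw [mul_comm]
    exact mul_le_mul_of_nonneg_left (mem_large.mp hv) h.rho_nonneg
  have hsmall' : D * ((large x θ).card : ℝ) ≤ g * η * n / 8 := by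
    have h1 : ((large x θ).card : ℝ) * (θ * P) ≤ D * n :=
      le_trans (by gcongr) hsmall
    have h2 : θ * P = 8 * D * D / (g * η) := by
      rw [hP]
      field_simp
    rw [h2] at h1
    have h3 : (0 : ℝ) < g * η := by positivity
    rw [mul_div_assoc', div_le_iff₀ h3] at h1
    have h4 : (D : ℝ) * (8 * (D * (large x θ).card)) ≤ D * (n * (g * η)) := by linarith
    have := le_of_mul_le_mul_left h4 (by linarith)
    linarith
  have hdeg : ∀ v ∈ large x η, g * η * n / (2 * D) ≤ (nbrs G Finset.univ v).card := by
    intro v hv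
    have h1 := h.rho_sq_mul_le_degree hθ0.le v
    have h2 : θ * D = g * η / 4 := by
      rw [hθ]
      field_simp
    have h3 : g * (n - g) * η ≤ ρ ^ 2 * x v :=
      mul_le_mul h.rho_sq (mem_large.mp hv) hη.le (sq_nonneg ρ)
    have h4 : (g : ℝ) * η * (8 * g) ≤ g * η * n := by
      refine mul_le_mul_of_nonneg_left ?_ (by positivity)
      nlinarith [sq_nonneg P]
    rw [h2, mul_add] at h1
    rw [div_le_iff₀ (by positivity)]
    nlinarith
  have hfin := h.card_large_mul_le η _ hdeg
  have h5 : ((large x η).card : ℝ) ≤ 2 * D * D / (g * η) := by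
    rw [le_div_iff₀ (by positivity)]
    rw [mul_div_assoc', div_le_iff₀ (by positivity)] at hfin
    have : n * ((large x η).card * (g * η)) ≤ n * (2 * D * D) := by linarith
    exact le_of_mul_le_mul_left this hn0
  exact_mod_cast h5.trans hK

/-- The common neighbours of a set of vertices. -/
noncomputable def common (G : SimpleGraph V) (A : Finset V) : Finset V :=
  A.inf fun a => nbrs G Finset.univ a

lemma mem_common {A : Finset V} {v : V} : v ∈ common G A ↔ ∀ a ∈ A, G.Adj a v := by
  simp [common, Finset.mem_inf, mem_nbrs]

/-- Union bound over the non-neighbourhoods of the vertices of `A`. -/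
lemma card_le_card_common_add (A : Finset V) :
    (Fintype.card V : ℝ) ≤ (common G A).card +
      ∑ a ∈ A, ((Fintype.card V : ℝ) - (nbrs G Finset.univ a).card) := by
  have h1 : (common G A)ᶜ ⊆ A.biUnion fun a => (nbrs G Finset.univ a)ᶜ := by
    intro v hv
    rw [Finset.mem_compl, mem_common] at hv
    push Not at hv
    obtain ⟨a, ha, hav⟩ := hv
    exact Finset.mem_biUnion.mpr ⟨a, ha, by simpa [mem_nbrs] using hav⟩
  have h2 := (Finset.card_le_card h1).trans Finset.card_biUnion_le
  have h3 : ∀ B : Finset V, ((Bᶜ).card : ℝ) = Fintype.card V - B.card := fun B => by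
    rw [Finset.card_compl, Nat.cast_sub (Finset.card_le_univ B)]
  have h4 : (((common G A)ᶜ.card : ℕ) : ℝ) ≤ ∑ a ∈ A, (((nbrs G Finset.univ a)ᶜ.card : ℕ) : ℝ) := by
    exact_mod_cast h2
  simp only [h3] at h4
  linarith

/-- Few vertices have more than `g` neighbours in a set of bounded size. -/
lemma card_many_nbrs_le {C : ℕ}
    (hC : ∀ A : Finset V, A.card = g + 1 → (common G A).card ≤ C) (L : Finset V) :
    (Finset.univ.filter fun w => g + 1 ≤ (nbrs G L w).card).card ≤ 2 ^ L.card * C := by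
  have h1 : (Finset.univ.filter fun w => g + 1 ≤ (nbrs G L w).card) ⊆
      (L.powersetCard (g + 1)).biUnion (common G) := by
    intro w hw
    obtain ⟨A, hA, hcard⟩ := Finset.exists_subset_card_eq (Finset.mem_filter.mp hw).2
    refine Finset.mem_biUnion.mpr ⟨A, Finset.mem_powersetCard.mpr
      ⟨hA.trans (nbrs_subset L w), hcard⟩, mem_common.mpr fun a ha => ?_⟩
    exact (mem_nbrs.mp (hA ha)).2.symm
  refine (Finset.card_le_card h1).trans (Finset.card_biUnion_le.trans ?_)
  calc ∑ A ∈ L.powersetCard (g + 1), (common G A).card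
      ≤ (L.powersetCard (g + 1)).card • C :=
        Finset.sum_le_card_nsmul _ _ _ fun A hA => hC A (Finset.mem_powersetCard.mp hA).2
    _ ≤ 2 ^ L.card * C := by
        rw [smul_eq_mul, Finset.card_powersetCard]
        exact Nat.mul_le_mul_right _ (Nat.choose_le_two_pow _ _)

/-- The walk estimate in which only the end vertices with at most `g` large neighbours are
kept. -/
lemma rho_sq_mul_le_few (h : SparseEigenvector G D g ρ x) {C K : ℕ}
    (hC : ∀ A : Finset V, A.card = g + 1 → (common G A).card ≤ C) {η : ℝ} (hη : 0 ≤ η)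
    (hK : (large x η).card ≤ K) (v : V) :
    ρ ^ 2 * x v ≤ η * D * Fintype.card V + (2 ^ K * C * K : ℕ) +
      ∑ w ∈ (nbrs G Finset.univ v).filter (fun w => (nbrs G (large x η) w).card ≤ g),
        ∑ u ∈ nbrs G (large x η) w, x u := by
  refine (h.rho_sq_mul_le hη v).trans ?_
  rw [add_assoc]
  refine add_le_add_right ?_ _
  rw [← Finset.sum_filter_add_sum_filter_not (nbrs G Finset.univ v)
    (fun w => (nbrs G (large x η) w).card ≤ g), add_comm]
  refine add_le_add_left ?_ _
  set W := (nbrs G Finset.univ v).filter fun w => ¬ (nbrs G (large x η) w).card ≤ g with hW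
  have h1 : W.card ≤ 2 ^ K * C := by
    refine le_trans (Finset.card_le_card ?_) ((card_many_nbrs_le hC (large x η)).trans
      (Nat.mul_le_mul_right _ (Nat.pow_le_pow_right (by norm_num) hK)))
    intro w hw
    rw [hW, Finset.mem_filter] at hw
    exact Finset.mem_filter.mpr ⟨Finset.mem_univ w, by omega⟩
  calc ∑ w ∈ W, ∑ u ∈ nbrs G (large x η) w, x u ≤ W.card • (K : ℝ) := by
        refine Finset.sum_le_card_nsmul _ _ _ fun w _ => (h.sum_nbrs_le_card _ w).trans ?_
        exact_mod_cast (Finset.card_le_card (nbrs_subset _ w)).trans hK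
    _ ≤ _ := by
        rw [nsmul_eq_mul]
        exact_mod_cast Nat.mul_le_mul_right K h1

/-- The eigenvector is concentrated on `g` vertices with many common neighbours. -/
theorem exists_core (D g C M : ℕ) (hD : 1 ≤ D) (hg : 1 ≤ g) {δ : ℝ} (hδ : 0 < δ) (hδ1 : δ ≤ 1) :
    ∃ N : ℕ, ∀ {V : Type} [Fintype V] [DecidableEq V] {G : SimpleGraph V} {ρ : ℝ} {x : V → ℝ},
      SparseEigenvector G D g ρ x → N ≤ Fintype.card V → (∃ v, x v = 1) →
      (∀ A : Finset V, A.card = g + 1 → (common G A).card ≤ C) →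
      ∃ L : Finset V, L.card = g ∧ M ≤ (common G L).card ∧ (∀ v ∈ L, 1 / 2 ≤ x v) ∧
        ∀ v, v ∉ L → x v ≤ δ := by
  have hD' : (1 : ℝ) ≤ D := by exact_mod_cast hD
  have hg' : (1 : ℝ) ≤ g := by exact_mod_cast hg
  -- Chosen so that the total loss `(2 * g + 2) * ε` in the last estimate is `δ / 2`.
  set ε : ℝ := δ / (4 * (g + 1)) with hε
  have hε0 : 0 < ε := by positivity
  have hεδ : (2 * g + 2) * ε = δ / 2 := by
    rw [hε]
    field_simp
    ring
  have hε1 : ε ≤ 1 / 8 := by nlinarith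
  set η : ℝ := ε / (2 * D) with hη
  have hη0 : 0 < η := by positivity
  have hηD : η * D = ε / 2 := by
    rw [hη]
    field_simp
  obtain ⟨N, K, hNK⟩ := exists_card_large_le D g hD hg hη0
  set K' : ℕ := 2 ^ K * C * K with hK'
  obtain ⟨N₁, hN₁⟩ := exists_nat_gt ((2 * (K' + g ^ 2)) / ε : ℝ)
  obtain ⟨N₂, hN₂⟩ := exists_nat_gt (2 * C / δ : ℝ)
  refine ⟨max (max N N₁) (max N₂ (2 * M)), fun {V} _ _ {G ρ x} h hV hv1 hC => ?_⟩
  simp only [max_le_iff] at hV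
  have hL := hNK h hV.1.1
  set L := large x η with hLdef
  set n : ℝ := (Fintype.card V : ℝ) with hn
  have hn1 : K' + (g : ℝ) ^ 2 < ε * n / 2 := by
    have : (N₁ : ℝ) ≤ n := by rw [hn]; exact_mod_cast hV.1.2
    have := (div_lt_iff₀ hε0).mp (hN₁.trans_le this)
    linarith
  have hn2 : (C : ℝ) < δ * n / 2 := by
    have : (N₂ : ℝ) ≤ n := by rw [hn]; exact_mod_cast hV.2.1
    have := (div_lt_iff₀ hδ).mp (hN₂.trans_le this)
    linarith
  have hn3 : 2 * (M : ℝ) ≤ n := by rw [hn]; exact_mod_cast hV.2.2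
  have hn0 : 0 ≤ n := by positivity
  have hkey : ∀ v, g * n * x v ≤ ε * n +
      ∑ w ∈ (nbrs G Finset.univ v).filter (fun w => (nbrs G L w).card ≤ g),
        ∑ u ∈ nbrs G L w, x u := by
    intro v
    have h1 := h.rho_sq_mul_le_few hC hη0.le hL v
    have h2 := mul_le_mul_of_nonneg_right h.rho_sq (h.nonneg v)
    have h3 : (g : ℝ) ^ 2 * x v ≤ g ^ 2 := mul_le_of_le_one_right (by positivity) (h.le_one v)
    rw [hηD] at h1
    nlinarith
  have hdeg : ∀ v, g * (n - (nbrs G Finset.univ v).card) ≤ g * n * (1 - x v) + ε * n := by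
    intro v
    have h1 : ∑ w ∈ (nbrs G Finset.univ v).filter (fun w => (nbrs G L w).card ≤ g),
        ∑ u ∈ nbrs G L w, x u ≤ (nbrs G Finset.univ v).card * (g : ℝ) := by
      calc _ ≤ ((nbrs G Finset.univ v).filter
              (fun w => (nbrs G L w).card ≤ g)).card • (g : ℝ) := by
            refine Finset.sum_le_card_nsmul _ _ _ fun w hw => (h.sum_nbrs_le_card _ w).trans ?_
            exact_mod_cast (Finset.mem_filter.mp hw).2
        _ ≤ _ := by
            rw [nsmul_eq_mul]
            gcongr
            exact Finset.filter_subset _ _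
    have := hkey v
    linarith
  have hdeg' : ∀ v, n - (nbrs G Finset.univ v).card ≤ n * (1 - x v) + ε * n := by
    intro v
    have h1 : g * (n - (nbrs G Finset.univ v).card) ≤ g * (n * (1 - x v) + ε * n) := by
      have : ε * n ≤ g * (ε * n) := le_mul_of_one_le_left (by positivity) hg'
      linarith [hdeg v]
    exact le_of_mul_le_mul_left h1 (by linarith)
  -- Averaging the walks from a vertex with entry one. The end found here has at most `g` large
  -- neighbours of total weight almost `g`, so exactly `g`, all with entries near one; they form the
  -- core.
  obtain ⟨w, hw, hws⟩ : ∃ w, (nbrs G L w).card ≤ g ∧ g - 2 * ε < ∑ u ∈ nbrs G L w, x u := by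
    obtain ⟨v, hv⟩ := hv1
    by_contra! hcon
    have h1 := hkey v
    have h2 : ∑ w ∈ (nbrs G Finset.univ v).filter (fun w => (nbrs G L w).card ≤ g),
        ∑ u ∈ nbrs G L w, x u ≤ n * (g - 2 * ε) := by
      calc _ ≤ ((nbrs G Finset.univ v).filter
              (fun w => (nbrs G L w).card ≤ g)).card • (g - 2 * ε : ℝ) :=
            Finset.sum_le_card_nsmul _ _ _ fun w hw => hcon w (Finset.mem_filter.mp hw).2
        _ ≤ _ := by
            rw [nsmul_eq_mul]
            refine mul_le_mul_of_nonneg_right ?_ (by linarith)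
            rw [hn]
            exact_mod_cast Finset.card_le_univ _
    rw [hv] at h1
    nlinarith
  set L₀ := nbrs G L w with hL₀
  have hL₀g : L₀.card = g := by
    refine le_antisymm hw ?_
    have h1 := h.sum_nbrs_le_card L w
    have h2 : (g : ℝ) < L₀.card + 1 := by linarith
    have h3 : g < L₀.card + 1 := by exact_mod_cast h2
    omega
  have hL₀x : ∀ u ∈ L₀, 1 - 2 * ε ≤ x u := by
    intro u hu
    have h1 : ∑ z ∈ L₀.erase u, x z ≤ (L₀.erase u).card • (1 : ℝ) :=
      Finset.sum_le_card_nsmul _ _ _ fun z _ => h.le_one z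
    rw [nsmul_eq_mul, mul_one, Finset.card_erase_of_mem hu, hL₀g, Nat.cast_sub hg,
      Nat.cast_one] at h1
    rw [← Finset.add_sum_erase _ _ hu] at hws
    linarith
  have hsum : ∑ a ∈ L₀, (n - (nbrs G Finset.univ a).card) ≤ (2 * g + 1) * ε * n := by
    have h1 : ∀ a ∈ L₀, n - (nbrs G Finset.univ a).card ≤ ((2 * g + 1) * ε * n) / g := by
      intro a ha
      rw [le_div_iff₀ (by linarith)]
      have h2 : g * n * (1 - x a) ≤ g * n * (2 * ε) :=
        mul_le_mul_of_nonneg_left (by linarith [hL₀x a ha]) (by positivity)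
      linarith [hdeg a]
    refine (Finset.sum_le_card_nsmul _ _ _ h1).trans_eq ?_
    rw [hL₀g, nsmul_eq_mul]
    field_simp
  refine ⟨L₀, hL₀g, ?_, fun v hv => by linarith [hL₀x v hv], fun v hv => ?_⟩
  · have h1 := card_le_card_common_add (G := G) L₀
    rw [← hn] at h1
    have h2 : (2 * g + 1) * ε * n ≤ 1 / 2 * n :=
      mul_le_mul_of_nonneg_right (by linarith) hn0
    have h3 : (M : ℝ) ≤ (common G L₀).card := by linarith
    exact_mod_cast h3
  -- A further vertex with entry above `δ` has degree about `δ * n` or more, so together with the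
  -- core it has at least `δ * n / 2 > C` common neighbours.
  · by_contra! hlt
    have h1 := card_le_card_common_add (G := G) (insert v L₀)
    rw [← hn, Finset.sum_insert hv] at h1
    have h2 : ((common G (insert v L₀)).card : ℝ) ≤ C := by
      exact_mod_cast hC _ (by rw [Finset.card_insert_of_notMem hv, hL₀g])
    have h3 := hdeg' v
    have h4 : n * (1 - x v) ≤ n * (1 - δ) := mul_le_mul_of_nonneg_left (by linarith) hn0
    have h5 : (2 * g + 2) * ε * n = δ / 2 * n := by rw [hεδ]
    linarith

end SparseEigenvector

end SpectralMinor

/-! ### Comparing the extremal graph with a book. -/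

namespace SpectralMinor

/-- The graph in which the vertices of `L` are adjacent to everything and the other edges are the
ones in `F`. -/
def bookOn {V : Type*} (L : Finset V) (F : Finset (Sym2 V)) : SimpleGraph V where
  Adj u v := u ≠ v ∧ (u ∈ L ∨ v ∈ L ∨ s(u, v) ∈ F)
  symm := ⟨fun u v h => ⟨h.1.symm, by
    rw [Sym2.eq_swap]
    exact or_left_comm.mp h.2⟩⟩
  loopless := ⟨fun _ h => h.1 rfl⟩

section Compare

variable {V : Type*} [Fintype V] [DecidableEq V] {G : SimpleGraph V}

omit [Fintype V] [DecidableEq V] in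
lemma bookOn_adj {L : Finset V} {F : Finset (Sym2 V)} {u v : V} :
    (bookOn L F).Adj u v ↔ u ≠ v ∧ (u ∈ L ∨ v ∈ L ∨ s(u, v) ∈ F) := Iff.rfl

/-- Moving every edge outside `L` to a missing pair with a vertex of `L` does not decrease the
quadratic form. -/
lemma adjForm_add_le_bookOn {L R : Finset V} {F : Finset (Sym2 V)} {D : ℕ} {x : V → ℝ} {δ : ℝ}
    (hx : ∀ v, 0 ≤ x v) (hL : ∀ u ∈ L, 1 / 2 ≤ x u) (hδ : ∀ v, v ∉ L → x v ≤ δ)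
    (hR : ∀ v, v ∈ R ↔ ∀ u ∈ L, G.Adj u v)
    (hRF : ∀ u ∈ R, ∀ v ∈ R, G.Adj u v → s(u, v) ∈ F)
    (hRnbrs : ∀ v, v ∉ L → v ∉ R → (nbrs G R v).card ≤ 2)
    (hD : ∀ X : Finset V, ∑ v ∈ X, (nbrs G X v).card ≤ D * X.card)
    (hsmall : (2 * D + 4) * δ ≤ 1 / 4) :
    adjForm G x + 1 / 4 * ∑ v ∈ Finset.univ.filter (fun v => v ∉ L ∧ v ∉ R), x v ≤
      adjForm (bookOn L F) x := by
  classical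
  set T : Finset V := Finset.univ.filter (fun v => v ∉ L ∧ v ∉ R) with hT
  have hT' : ∀ v, v ∈ T ↔ v ∉ L ∧ v ∉ R := fun v => by simp [hT]
  have hRL : ∀ v ∈ R, v ∉ L := fun v hv hvL => ((hR v).mp hv v hvL).ne rfl
  have hTx : 0 ≤ ∑ v ∈ T, x v := Finset.sum_nonneg fun v _ => hx v
  -- `a` records the gained pairs from `T` to `L`, and `t` and `b` the pairs that may be lost,
  -- inside `T` and between `T` and `R`. The losses total at most `(2 * D + 4) * δ` times the weight
  -- of `T`, against a gain of at least half that weight.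
  set a : V → V → ℝ := fun u v => if u ∈ T ∧ v ∈ L ∧ ¬ G.Adj u v then x u * x v else 0 with ha
  set t : V → V → ℝ := fun u v => if u ∈ T ∧ v ∈ T ∧ G.Adj u v then x u * x v else 0 with ht
  set b : V → V → ℝ := fun u v => if u ∈ T ∧ v ∈ R ∧ G.Adj u v then x u * x v else 0 with hb
  have hxx : ∀ u v, 0 ≤ x u * x v := fun u v => mul_nonneg (hx u) (hx v)
  have hpt : ∀ u v, (if G.Adj u v then x u * x v else 0) + a u v ≤
      (if (bookOn L F).Adj u v then x u * x v else 0) + t u v + b u v + b v u := by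
    intro u v
    have ht0 : 0 ≤ t u v := by simp only [ht]; split_ifs <;> simp [hxx]
    have hb0 : ∀ u v, 0 ≤ b u v := fun u v => by simp only [hb]; split_ifs <;> simp [hxx]
    have hb1 := hb0 u v
    have hb2 := hb0 v u
    have hH0 : 0 ≤ if (bookOn L F).Adj u v then x u * x v else 0 := by split_ifs <;> simp [hxx]
    by_cases hG : G.Adj u v
    · have ha0 : a u v = 0 := if_neg fun h => h.2.2 hG
      rw [if_pos hG, ha0, add_zero]
      by_cases hH : (bookOn L F).Adj u v
      · rw [if_pos hH]
        linarith
      · rw [bookOn_adj] at hH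
        push Not at hH
        obtain ⟨huL, hvL, huv⟩ := hH hG.ne
        by_cases huR : u ∈ R
        · by_cases hvR : v ∈ R
          · exact absurd (hRF u huR v hvR hG) huv
          · have : b v u = x v * x u := if_pos ⟨(hT' v).mpr ⟨hvL, hvR⟩, huR, hG.symm⟩
            rw [mul_comm] at this
            linarith
        · by_cases hvR : v ∈ R
          · have : b u v = x u * x v := if_pos ⟨(hT' u).mpr ⟨huL, huR⟩, hvR, hG⟩
            linarith
          · have : t u v = x u * x v :=
              if_pos ⟨(hT' u).mpr ⟨huL, huR⟩, (hT' v).mpr ⟨hvL, hvR⟩, hG⟩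
            linarith
    · rw [if_neg hG, zero_add]
      by_cases h : u ∈ T ∧ v ∈ L ∧ ¬ G.Adj u v
      · have hH : (bookOn L F).Adj u v := by
          refine ⟨?_, Or.inr (Or.inl h.2.1)⟩
          rintro rfl
          exact ((hT' u).mp h.1).1 h.2.1
        have : a u v = x u * x v := if_pos h
        rw [if_pos hH]
        linarith
      · have : a u v = 0 := if_neg h
        linarith
  have hsum : adjForm G x + ∑ u, ∑ v, a u v ≤
      adjForm (bookOn L F) x + ∑ u, ∑ v, t u v + ∑ u, ∑ v, b u v + ∑ u, ∑ v, b u v := by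
    have h1 : ∑ u, ∑ v, b v u = ∑ u, ∑ v, b u v := Finset.sum_comm
    nth_rewrite 2 [← h1]
    unfold adjForm
    simp only [← Finset.sum_add_distrib]
    exact Finset.sum_le_sum fun u _ => Finset.sum_le_sum fun v _ => hpt u v
  have ha1 : 1 / 2 * ∑ v ∈ T, x v ≤ ∑ u, ∑ v, a u v := by
    have ha0 : ∀ u v, 0 ≤ a u v := fun u v => by simp only [ha]; split_ifs <;> simp [hxx]
    rw [Finset.mul_sum]
    refine le_trans (Finset.sum_le_sum fun u hu => ?_) (Finset.sum_le_sum_of_subset_of_nonneg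
      (Finset.subset_univ T) fun u _ _ => Finset.sum_nonneg fun v _ => ha0 u v)
    have huR := ((hT' u).mp hu).2
    rw [hR] at huR
    push Not at huR
    obtain ⟨v, hv, huv⟩ := huR
    refine le_trans ?_ (Finset.single_le_sum (fun v _ => ha0 u v) (Finset.mem_univ v))
    have : a u v = x u * x v := if_pos ⟨hu, hv, fun h => huv h.symm⟩
    rw [this, mul_comm]
    exact mul_le_mul_of_nonneg_left (hL v hv) (hx u)
  have ht1 : ∑ u, ∑ v, t u v ≤ 2 * D * δ * ∑ v ∈ T, x v := by
    refine le_trans (le_of_eq ?_) (sum_sum_adj_le hD hx T fun v hv => hδ v ((hT' v).mp hv).1)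
    rw [← Finset.sum_filter_add_sum_filter_not Finset.univ (fun u => u ∈ T), Finset.filter_univ_mem]
    rw [Finset.sum_eq_zero (s := Finset.univ.filter fun u => ¬ u ∈ T), add_zero]
    · refine Finset.sum_congr rfl fun u hu => ?_
      rw [Finset.mul_sum, ← Finset.sum_subset (Finset.subset_univ (nbrs G T u))]
      · refine Finset.sum_congr rfl fun v hv => ?_
        rw [mem_nbrs] at hv
        exact if_pos ⟨hu, hv⟩
      · intro v _ hv
        rw [mem_nbrs] at hv
        exact if_neg fun h => hv h.2
    · intro u hu
      exact Finset.sum_eq_zero fun v _ => if_neg fun h => (Finset.mem_filter.mp hu).2 h.1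
  have hb1 : ∑ u, ∑ v, b u v ≤ 2 * δ * ∑ v ∈ T, x v := by
    rw [← Finset.sum_filter_add_sum_filter_not Finset.univ (fun u => u ∈ T), Finset.filter_univ_mem]
    rw [Finset.sum_eq_zero (s := Finset.univ.filter fun u => ¬ u ∈ T), add_zero, Finset.mul_sum]
    · refine Finset.sum_le_sum fun u hu => ?_
      have hu' := (hT' u).mp hu
      have hδ0 : 0 ≤ δ := (hx u).trans (hδ u hu'.1)
      rw [← Finset.sum_subset (Finset.subset_univ (nbrs G R u))]
      · calc ∑ v ∈ nbrs G R u, b u v ≤ (nbrs G R u).card • (δ * x u) := by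
              refine Finset.sum_le_card_nsmul _ _ _ fun v hv => ?_
              have hv' := mem_nbrs.mp hv
              have : b u v = x u * x v := if_pos ⟨hu, hv'⟩
              rw [this, mul_comm]
              exact mul_le_mul_of_nonneg_right (hδ v (hRL v hv'.1)) (hx u)
          _ ≤ 2 * δ * x u := by
              rw [nsmul_eq_mul, mul_assoc]
              refine mul_le_mul_of_nonneg_right ?_ (mul_nonneg hδ0 (hx u))
              exact_mod_cast hRnbrs u hu'.1 hu'.2
      · intro v _ hv
        rw [mem_nbrs] at hv
        exact if_neg fun h => hv h.2
    · intro u hu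
      exact Finset.sum_eq_zero fun v _ => if_neg fun h => (Finset.mem_filter.mp hu).2 h.1
  have hfin := mul_le_mul_of_nonneg_right hsmall hTx
  linarith

/-- If the book on `L` has no larger spectral radius than `G`, then `G` is that book. -/
lemma eq_bookOn {L R : Finset V} {F : Finset (Sym2 V)} {D : ℕ} {x : V → ℝ} {δ ρ : ℝ}
    (hx : ∀ v, 0 ≤ x v) (hL : ∀ u ∈ L, 1 / 2 ≤ x u) (hδ : ∀ v, v ∉ L → x v ≤ δ)
    (hR : ∀ v, v ∈ R ↔ ∀ u ∈ L, G.Adj u v)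
    (hRF : ∀ u ∈ R, ∀ v ∈ R, G.Adj u v → s(u, v) ∈ F)
    (hRnbrs : ∀ v, v ∉ L → v ∉ R → (nbrs G R v).card ≤ 2)
    (hD : ∀ X : Finset V, ∑ v ∈ X, (nbrs G X v).card ≤ D * X.card)
    (hsmall : (2 * D + 4) * δ ≤ 1 / 4) (hL2 : 2 ≤ L.card)
    (hGx : adjForm G x = ρ * ∑ v, x v ^ 2)
    (hρ : ∀ y, adjForm (bookOn L F) y ≤ ρ * ∑ v, y v ^ 2) : G = bookOn L F := by
  classical
  have hle := adjForm_add_le_bookOn hx hL hδ hR hRF hRnbrs hD hsmall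
  set T : Finset V := Finset.univ.filter (fun v => v ∉ L ∧ v ∉ R) with hT
  have hTx : 0 ≤ ∑ v ∈ T, x v := Finset.sum_nonneg fun v _ => hx v
  have hHx : adjForm (bookOn L F) x = ρ * ∑ v, x v ^ 2 :=
    le_antisymm (hρ x) (by linarith)
  -- The book attains its maximum at `x` too, so `x` is an eigenvector of it. A zero entry would
  -- force zeros on all neighbours, yet every vertex has another vertex of `L` as a neighbour.
  have hpos : ∀ v, 0 < x v := by
    intro v
    refine lt_of_le_of_ne (hx v) fun h0 => ?_
    obtain ⟨u, hu, huv⟩ := Finset.exists_mem_ne (by omega : 1 < L.card) v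
    have h1 := sum_nbrs_eq_of_max hρ hHx v
    rw [← h0, mul_zero] at h1
    have h2 := (Finset.sum_eq_zero_iff_of_nonneg fun u _ => hx u).mp h1 u
      (mem_nbrs.mpr ⟨Finset.mem_univ u, huv.symm, Or.inr (Or.inl hu)⟩)
    linarith [hL u hu]
  have hTe : ∀ v, v ∉ L → v ∈ R := by
    intro v hv
    by_contra hvR
    have : x v ≤ ∑ v ∈ T, x v :=
      Finset.single_le_sum (fun v _ => hx v) (by simp [hT, hv, hvR])
    linarith [hpos v]
  have hGle : ∀ u v, G.Adj u v → (bookOn L F).Adj u v := by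
    intro u v huv
    refine ⟨huv.ne, ?_⟩
    by_cases hu : u ∈ L
    · exact Or.inl hu
    · by_cases hv : v ∈ L
      · exact Or.inr (Or.inl hv)
      · exact Or.inr (Or.inr (hRF u (hTe u hu) v (hTe v hv) huv))
  ext u v
  refine ⟨hGle u v, fun h => ?_⟩
  by_contra hG
  have hxx : ∀ u v, 0 < x u * x v := fun u v => mul_pos (hpos u) (hpos v)
  have hpt : ∀ u v, (if G.Adj u v then x u * x v else 0) ≤
      if (bookOn L F).Adj u v then x u * x v else 0 := by
    intro u v
    by_cases h : G.Adj u v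
    · rw [if_pos h, if_pos (hGle u v h)]
    · rw [if_neg h]
      split_ifs
      · exact (hxx u v).le
      · exact le_rfl
  have : adjForm G x < adjForm (bookOn L F) x := by
    refine Finset.sum_lt_sum (fun u _ => Finset.sum_le_sum fun v _ => hpt u v)
      ⟨u, Finset.mem_univ u, Finset.sum_lt_sum (fun v _ => hpt u v) ⟨v, Finset.mem_univ v, ?_⟩⟩
    rw [if_neg hG, if_pos h]
    exact hxx u v
  linarith

end Compare

end SpectralMinor

/-! ### Isomorphisms with the standard books. -/

namespace SpectralMinor

section Isomorphisms

variable {V : Type*} [Fintype V] [DecidableEq V]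

-- Any bijection from `L` to the clique side works, so only the bijection `σ` outside `L` has to
-- respect edges.
omit [Fintype V] in
lemma nonempty_bookOn_iso {L : Finset V} {F : Finset (Sym2 V)} {s t : ℕ} (hs : L.card = s)
    (K : SimpleGraph (Fin t)) (σ : {v // v ∉ L} ≃ Fin t)
    (hK : ∀ u v : {v // v ∉ L}, K.Adj (σ u) (σ v) ↔ u.1 ≠ v.1 ∧ s(u.1, v.1) ∈ F) :
    Nonempty (bookOn L F ≃g join (⊤ : SimpleGraph (Fin s)) K) := by
  let τ : {v // v ∈ L} ≃ Fin s := Fintype.equivFinOfCardEq (by simpa using hs)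
  let e : V ≃ Fin s ⊕ Fin t := (Equiv.sumCompl (· ∈ L)).symm.trans (Equiv.sumCongr τ σ)
  have hl : ∀ u (hu : u ∈ L), e u = Sum.inl (τ ⟨u, hu⟩) := fun u hu => by
    simp [e, Equiv.sumCompl_symm_apply_of_pos hu]
  have hr : ∀ u (hu : u ∉ L), e u = Sum.inr (σ ⟨u, hu⟩) := fun u hu => by
    simp [e, Equiv.sumCompl_symm_apply_of_neg hu]
  refine ⟨⟨e, fun {u v} => ?_⟩⟩
  by_cases hu : u ∈ L <;> by_cases hv : v ∈ L
  · rw [hl u hu, hl v hv, bookOn_adj]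
    simp [join, hu]
  · rw [hl u hu, hr v hv, bookOn_adj]
    have : u ≠ v := fun h => hv (h ▸ hu)
    simp [join, hu, this]
  · rw [hr u hu, hl v hv, bookOn_adj]
    have : u ≠ v := fun h => hu (h ▸ hv)
    simp [join, hv, this]
  · rw [hr u hu, hr v hv, bookOn_adj]
    simpa [join, hu, hv] using hK ⟨u, hu⟩ ⟨v, hv⟩

lemma card_notMem {L : Finset V} {n s : ℕ} (hn : Fintype.card V = n) (hs : L.card = s) :
    Fintype.card {v // v ∉ L} = n - s := by
  rw [← hn, Fintype.card_subtype_compl, Fintype.card_coe, hs]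

lemma nonempty_bookOn_iso_book {L : Finset V} {n s : ℕ} (hn : Fintype.card V = n)
    (hs : L.card = s) :
    Nonempty (bookOn L ∅ ≃g book s (n - s)) :=
  nonempty_bookOn_iso hs ⊥ (Fintype.equivFinOfCardEq (card_notMem hn hs)) (by simp)

lemma exists_equiv_fin_apply_eq {α : Type*} [Fintype α] {t : ℕ} (ht : Fintype.card α = t)
    {p q : α} (hpq : p ≠ q) : ∃ σ : α ≃ Fin t, (σ p).val = 0 ∧ (σ q).val = 1 := by
  classical
  have h1 : 1 < Fintype.card α := Fintype.one_lt_card_iff.mpr ⟨p, q, hpq⟩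
  let z : Fin t := ⟨0, by omega⟩
  let o : Fin t := ⟨1, by omega⟩
  have hzo : z ≠ o := by simp [z, o]
  let σ₀ : α ≃ Fin t := Fintype.equivFinOfCardEq ht
  let σ₁ : α ≃ Fin t := σ₀.trans (Equiv.swap (σ₀ p) z)
  have hp : σ₁ p = z := by simp [σ₁]
  refine ⟨σ₁.trans (Equiv.swap (σ₁ q) o), ?_, ?_⟩
  · have : σ₁ q ≠ z := fun h => hpq (σ₁.injective (hp.trans h.symm))
    rw [Equiv.trans_apply, hp, Equiv.swap_apply_of_ne_of_ne this.symm hzo]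
  · rw [Equiv.trans_apply, Equiv.swap_apply_left]

lemma nonempty_bookOn_iso_bookOne {L : Finset V} {n s : ℕ}
    (hn : Fintype.card V = n) (hs : L.card = s) {p q : V}
    (hp : p ∉ L) (hq : q ∉ L) (hpq : p ≠ q) :
    Nonempty (bookOn L {s(p, q)} ≃g bookOne s (n - s)) := by
  obtain ⟨σ, h0, h1⟩ := exists_equiv_fin_apply_eq (card_notMem hn hs) (p := ⟨p, hp⟩) (q := ⟨q, hq⟩)
    (by simpa using hpq)
  refine nonempty_bookOn_iso hs _ σ fun u v => ?_
  have e0 : ∀ u, (σ u).val = 0 ↔ u.1 = p := fun u => by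
    rw [← h0, ← Fin.ext_iff, σ.apply_eq_iff_eq, Subtype.ext_iff]
  have e1 : ∀ u, (σ u).val = 1 ↔ u.1 = q := fun u => by
    rw [← h1, ← Fin.ext_iff, σ.apply_eq_iff_eq, Subtype.ext_iff]
  rw [oneEdge, SimpleGraph.fromRel_adj, e0, e1, e0, e1, σ.injective.ne_iff, Finset.mem_singleton,
    Sym2.eq_iff, ne_eq, Subtype.ext_iff]
  tauto

end Isomorphisms

/-! ### Extremal graphs and the proof of the theorem. -/

section Extremal

/-- The spectral radius of a book is at least that of the complete bipartite graph inside it. -/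
lemma mul_sub_le_sq_of_bookOn {V : Type*} [Fintype V] [DecidableEq V] {L : Finset V} {ρ : ℝ}
    (hL : 0 < L.card)
    (hρ : ∀ y, adjForm (bookOn L ∅) y ≤ ρ * ∑ v, y v ^ 2) :
    (L.card : ℝ) * (Fintype.card V - L.card) ≤ ρ ^ 2 := by
  set g : ℝ := (L.card : ℝ) with hg
  have hg0 : 0 < g := by rw [hg]; exact_mod_cast hL
  set m : ℝ := Fintype.card V - g with hm
  have hm' : ((Lᶜ.card : ℕ) : ℝ) = m := by
    rw [Finset.card_compl, Nat.cast_sub (Finset.card_le_univ L)]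
  rcases (show 0 ≤ m by rw [← hm']; positivity).eq_or_lt with h0 | hm0
  · rw [← h0, mul_zero]
    positivity
  set a := Real.sqrt m with ha
  set b := Real.sqrt g with hb
  have ha2 : a ^ 2 = m := Real.sq_sqrt hm0.le
  have hb2 : b ^ 2 = g := Real.sq_sqrt hg0.le
  have ha0 : 0 < a := Real.sqrt_pos.mpr hm0
  have hb0 : 0 < b := Real.sqrt_pos.mpr hg0
  -- The leading eigenvector of the complete bipartite graph between `L` and its complement.
  set y : V → ℝ := fun v => if v ∈ L then a else b with hy
  have hy0 : ∀ v, 0 ≤ y v := fun v => by simp only [hy]; split_ifs <;> positivity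
  have hyL : ∀ v ∈ L, y v = a := fun v hv => if_pos hv
  have hyL' : ∀ v ∈ Lᶜ, y v = b := fun v hv => if_neg (Finset.mem_compl.mp hv)
  have h1 : ∑ v, y v ^ 2 = 2 * (g * m) := by
    rw [← Finset.sum_add_sum_compl L, Finset.sum_congr rfl fun v hv => by rw [hyL v hv],
      Finset.sum_congr (s₁ := Lᶜ) rfl fun v hv => by rw [hyL' v hv], Finset.sum_const,
      Finset.sum_const, nsmul_eq_mul, nsmul_eq_mul, hm', ha2, hb2]
    ring
  have h2 : 2 * (g * m) * (a * b) ≤ adjForm (bookOn L ∅) y := by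
    have hL1 : ∀ v ∈ L, a * (m * b) ≤
        y v * ∑ u ∈ nbrs (bookOn L ∅) Finset.univ v, y u := by
      intro v hv
      rw [hyL v hv]
      refine mul_le_mul_of_nonneg_left ?_ ha0.le
      calc m * b = ∑ u ∈ Lᶜ, y u := by
            rw [Finset.sum_congr rfl hyL', Finset.sum_const, nsmul_eq_mul, hm']
        _ ≤ _ := Finset.sum_le_sum_of_subset_of_nonneg (fun u hu => mem_nbrs.mpr
            ⟨Finset.mem_univ u, bookOn_adj.mpr
              ⟨fun h => Finset.mem_compl.mp hu (h ▸ hv), Or.inl hv⟩⟩)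
            fun u _ _ => hy0 u
    have hL2 : ∀ v ∈ Lᶜ, b * (g * a) ≤
        y v * ∑ u ∈ nbrs (bookOn L ∅) Finset.univ v, y u := by
      intro v hv
      rw [hyL' v hv]
      refine mul_le_mul_of_nonneg_left ?_ hb0.le
      calc g * a = ∑ u ∈ L, y u := by
            rw [Finset.sum_congr rfl hyL, Finset.sum_const, nsmul_eq_mul]
        _ ≤ _ := Finset.sum_le_sum_of_subset_of_nonneg (fun u hu => mem_nbrs.mpr
            ⟨Finset.mem_univ u, bookOn_adj.mpr
              ⟨by rintro rfl; exact Finset.mem_compl.mp hv hu, Or.inr (Or.inl hu)⟩⟩)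
            fun u _ _ => hy0 u
    rw [adjForm_eq_sum_nbrs, ← Finset.sum_add_sum_compl L]
    refine le_trans (le_of_eq ?_) (add_le_add (Finset.card_nsmul_le_sum _ _ _ hL1)
      (Finset.card_nsmul_le_sum _ _ _ hL2))
    rw [nsmul_eq_mul, nsmul_eq_mul, hm']
    ring
  have h3 := h2.trans (hρ y)
  rw [h1, mul_comm ρ] at h3
  have h4 : a * b ≤ ρ := le_of_mul_le_mul_left h3 (by positivity)
  calc g * m = (a * b) ^ 2 := by rw [mul_pow, ha2, hb2]; ring
    _ ≤ ρ ^ 2 := pow_le_pow_left₀ (by positivity) h4 2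

/-- A graph of maximum spectral radius has a nonnegative eigenvector with largest entry one, and
its eigenvalue bounds the quadratic forms of all competitors. -/
lemma exists_eigenvector_of_mem_SPEX {n : ℕ} (hn : 0 < n) {W : Type*} {H : SimpleGraph W}
    {G : SimpleGraph (Fin n)} (hG : G ∈ SPEX n H) :
    ∃ (ρ : ℝ) (x : Fin n → ℝ), 0 ≤ ρ ∧ (∀ v, 0 ≤ x v) ∧ (∀ v, x v ≤ 1) ∧ (∃ v, x v = 1) ∧
      adjForm G x = ρ * ∑ v, x v ^ 2 ∧
      ∀ G' : SimpleGraph (Fin n), ¬ IsMinor H G' →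
        ∀ y, adjForm G' y ≤ ρ * ∑ v, y v ^ 2 := by
  have : Nonempty (Fin n) := ⟨⟨0, hn⟩⟩
  obtain ⟨ρ, x, h1, h2, h3, h4⟩ := exists_max_rayleigh G
  obtain ⟨v₀, -, hv₀⟩ := Finset.exists_max_image Finset.univ x Finset.univ_nonempty
  have hpos : 0 < x v₀ := by
    obtain ⟨v, hv⟩ := Function.ne_iff.mp h3
    exact (lt_of_le_of_ne (h2 v) (Ne.symm hv)).trans_le (hv₀ v (Finset.mem_univ v))
  have hρ0 : 0 ≤ ρ := by
    have h5 : 0 ≤ ρ * x v₀ := by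
      rw [← sum_nbrs_eq_of_max h1 h4]
      exact Finset.sum_nonneg fun u _ => h2 u
    exact nonneg_of_mul_nonneg_left h5 hpos
  refine ⟨ρ, fun v => (x v₀)⁻¹ * x v, hρ0, fun v => mul_nonneg (inv_nonneg.mpr hpos.le) (h2 v),
    fun v => ?_, ⟨v₀, inv_mul_cancel₀ hpos.ne'⟩, ?_, fun G' hG' y => ?_⟩
  · rw [inv_mul_le_iff₀ hpos, mul_one]
    exact hv₀ v (Finset.mem_univ v)
  · rw [adjForm_smul, h4]
    simp only [mul_pow, ← Finset.mul_sum]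
    ring
  · obtain ⟨ρ', x', h1', h2', h3', h4'⟩ := exists_max_rayleigh G'
    have hle := hG.2 G' hG'
    rw [graphSpectralRadius_eq h1 h3 h4, graphSpectralRadius_eq h1' h3' h4',
      ENNReal.ofReal_le_ofReal_iff hρ0] at hle
    exact (h1' y).trans (mul_le_mul_of_nonneg_right hle
      (Finset.sum_nonneg fun _ _ => sq_nonneg _))

/-- The book is a wheel-minor-free competitor, and a finite nonempty family attains its maximum. -/
lemma SPEX_wheel_nonempty {k n : ℕ} (hk : 3 ≤ k) (hn : (k + 1) / 2 ≤ n) :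
    (SPEX n (wheel k)).Nonempty := by
  classical
  obtain ⟨L, -, hL⟩ := Finset.exists_subset_card_eq (s := (Finset.univ : Finset (Fin n)))
    (n := (k + 1) / 2) (by simpa using hn)
  have hne : ({G : SimpleGraph (Fin n) | ¬ IsMinor (wheel k) G} : Set _).Nonempty :=
    ⟨bookOn L ∅, not_isMinor_wheel hk (by omega) hL.le (F := ∅)
      (by rw [Finset.card_empty]; omega) fun u v hu hv h => by
        rcases h.2 with h | h | h
        · exact absurd h hu
        · exact absurd h hv
        · exact h⟩
  obtain ⟨G, hG, hmax⟩ := Set.exists_max_image _ graphSpectralRadius (Set.toFinite _) hne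
  exact ⟨G, hG, fun G' hG' => hmax G' hG'⟩

/-- Large extremal graphs are books on a set of `⌈k / 2⌉` vertices, with one additional edge if
`k` is even. -/
lemma exists_eq_bookOn (k : ℕ) (hk : 3 ≤ k) (hk4 : k ≠ 4) :
    ∃ N : ℕ, ∀ n : ℕ, N ≤ n → ∀ G ∈ SPEX n (wheel k), ∃ L : Finset (Fin n),
      L.card = (k + 1) / 2 ∧ ((Odd k ∧ G = bookOn L ∅) ∨
        (Even k ∧ ∃ p q, p ∉ L ∧ q ∉ L ∧ p ≠ q ∧ G = bookOn L {s(p, q)})) := by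
  set g := (k + 1) / 2 with hg
  set D := 2 * (k - 1) with hD
  -- Gives `(2 * D + 4) * δ = 1 / 4`, the slack required by the comparison with the book.
  set δ : ℝ := 1 / (8 * (D + 2)) with hδ
  have hδ0 : 0 < δ := by positivity
  have hδ4 : (2 * D + 4) * δ ≤ 1 / 4 := by
    rw [hδ, mul_one_div, div_le_div_iff₀ (by positivity) (by norm_num)]
    linarith
  have hδ1 : δ ≤ 1 := by
    rw [hδ, div_le_one (by positivity)]
    have : (0 : ℝ) ≤ D := by positivity
    linarith
  have hg2 : 2 ≤ g := by omega
  -- At most `g` common neighbours for `g + 1` vertices, by the complete pair lemma; `g + 6` common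
  -- neighbours of the core leave room for the beads used in excluding extra edges.
  obtain ⟨N, hN⟩ := SparseEigenvector.exists_core D g g (g + 6) (by omega) (by omega) hδ0 hδ1
  refine ⟨max N g, fun n hn G hG => ?_⟩
  rw [max_le_iff] at hn
  obtain ⟨ρ, x, hρ0, hx0, hx1, hxv, hGx, hmax⟩ :=
    exists_eigenvector_of_mem_SPEX (by omega : 0 < n) hG
  have hfree : ∀ (L : Finset (Fin n)) (F : Finset (Sym2 (Fin n))), L.card = g →
      F.card + 2 * g ≤ k + 1 → ¬ IsMinor (wheel k) (bookOn L F) := by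
    intro L F hL hF
    refine not_isMinor_wheel hk hg2 hL.le hF fun u v hu hv h => ?_
    rcases h.2 with h | h | h
    · exact absurd h hu
    · exact absurd h hv
    · exact h
  have hsparse : ∀ X : Finset (Fin n), ∑ v ∈ X, (nbrs G X v).card ≤ D * X.card := by
    intro X
    by_contra! h
    rcases X.eq_empty_or_nonempty with rfl | hX
    · simp at h
    · exact hG.1 (isMinor_wheel_of_many_edges hk hX h.le)
  have hsv : SparseEigenvector G D g ρ x := by
    refine ⟨hsparse, hx0, hx1, sum_nbrs_eq_of_max (hmax G hG.1) hGx, hρ0, ?_⟩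
    obtain ⟨L, -, hL⟩ := Finset.exists_subset_card_eq (s := (Finset.univ : Finset (Fin n)))
      (n := g) (by simpa using hn.2)
    have := mul_sub_le_sq_of_bookOn (by omega)
      (hmax _ (hfree L ∅ hL (by rw [Finset.card_empty]; omega)))
    rwa [hL] at this
  obtain ⟨L, hLg, hcommon, hLx, hLδ⟩ := hN hsv (by simpa using hn.1) hxv fun A hA => by
    by_contra! h
    exact hG.1 (isMinor_wheel_of_complete_pair hk (by omega)
      (fun a ha r hr => SparseEigenvector.mem_common.mp hr a ha) hA.ge h)
  set R := SparseEigenvector.common G L with hR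
  have hLR : ∀ a ∈ L, ∀ r ∈ R, G.Adj a r := fun a ha r hr =>
    SparseEigenvector.mem_common.mp hr a ha
  have hRL : ∀ r ∈ R, r ∉ L := fun r hr => notMem_of_complete_pair hLR hr
  have hcon : ∀ F : Finset (Sym2 (Fin n)), F.card + 2 * g ≤ k + 1 →
      (∀ u ∈ R, ∀ v ∈ R, G.Adj u v → s(u, v) ∈ F) →
      (∀ v, v ∉ L → v ∉ R → (nbrs G R v).card ≤ 2) → G = bookOn L F :=
    fun F hF h1 h2 => eq_bookOn hx0 hLx hLδ (fun v => SparseEigenvector.mem_common) h1 h2 hsparse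
      hδ4 (by omega) hGx (hmax _ (hfree L F hLg hF))
  refine ⟨L, hLg, ?_⟩
  rcases Nat.even_or_odd k with hev | hodd
  · refine Or.inr ⟨hev, ?_⟩
    have hkg : k = 2 * g := by
      obtain ⟨m, hm⟩ := hev
      omega
    have hclaw : ∀ v, v ∉ L → v ∉ R → (nbrs G R v).card ≤ 2 := by
      intro v hv _
      by_contra! h
      obtain ⟨r, hr, s, hs, t, ht, hrs, hrt, hst⟩ := Finset.two_lt_card.mp h
      rw [mem_nbrs] at hr hs ht
      exact hG.1 (isMinor_wheel_of_claw hk hg2 hkg.le hLR hLg.ge hcommon hr.1 hs.1 ht.1 hrs hrt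
        hst hv hr.2 hs.2 ht.2)
    obtain ⟨p, hp, q, hq, hpq, hF⟩ : ∃ p ∈ R, ∃ q ∈ R, p ≠ q ∧
        ∀ u ∈ R, ∀ v ∈ R, G.Adj u v → s(u, v) ∈ ({s(p, q)} : Finset (Sym2 (Fin n))) := by
      by_cases hE : ∃ p ∈ R, ∃ q ∈ R, G.Adj p q
      · obtain ⟨p, hp, q, hq, hpq⟩ := hE
        refine ⟨p, hp, q, hq, hpq.ne, fun u hu v hv huv => ?_⟩
        rw [Finset.mem_singleton, Sym2.eq_iff]
        have hpath : ∀ a ∈ R, ∀ b ∈ R, ∀ c ∈ R, G.Adj a b → G.Adj a c → b = c := by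
          intro a ha b hb c hc hab hac
          by_contra h
          exact hG.1 (isMinor_wheel_of_path_three hk hg2 hkg.le hLR hLg.ge hcommon hb hc h ha
            hab hac)
        by_cases hpu : p = u
        · subst hpu
          exact Or.inl ⟨rfl, (hpath p hp q hq v hv hpq huv).symm⟩
        by_cases hpv : p = v
        · subst hpv
          exact Or.inr ⟨(hpath p hp q hq u hu hpq huv.symm).symm, rfl⟩
        by_cases hqu : q = u
        · subst hqu
          exact absurd (hpath q hq p hp v hv hpq.symm huv) hpv
        by_cases hqv : q = v
        · subst hqv
          exact absurd (hpath q hq p hp u hu hpq.symm huv.symm) hpu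
        exact absurd (isMinor_wheel_of_two_edges hk (by omega) hkg.le hLR hLg.ge hcommon hp hq hu
          hv hpq huv hpu hpv hqu hqv) hG.1
      -- If `R` spans no edge, any pair will do: the book with that extra edge is still
      -- wheel-minor-free, and the comparison applies to it.
      · obtain ⟨p, hp, q, hq, hpq⟩ := Finset.one_lt_card.mp (show 1 < R.card by omega)
        exact ⟨p, hp, q, hq, hpq, fun u hu v hv huv => absurd ⟨u, hu, v, hv, huv⟩ hE⟩
    exact ⟨p, q, hRL p hp, hRL q hq, hpq,
      hcon _ (by rw [Finset.card_singleton]; omega) hF hclaw⟩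
  · refine Or.inl ⟨hodd, ?_⟩
    have hkg : k + 1 = 2 * g := by
      obtain ⟨m, hm⟩ := hodd
      omega
    refine hcon ∅ (by rw [Finset.card_empty]; omega) (fun u hu v hv huv => ?_) fun v hv _ => ?_
    · exact absurd (isMinor_wheel_of_edge hk hg2 hkg.le hLR hLg.ge hcommon hu hv huv) hG.1
    · by_contra! h
      obtain ⟨r, hr, s, hs, hrs⟩ := Finset.one_lt_card.mp (by omega : 1 < (nbrs G R v).card)
      rw [mem_nbrs] at hr hs
      exact hG.1 (isMinor_wheel_of_cherry hk hg2 hkg.le hLR hLg.ge hcommon hr.1 hs.1 hrs hv hr.2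
        hs.2)

/-- If extremal graphs exist and all of them are isomorphic to `B`, then the extremal graphs are
exactly the graphs isomorphic to `B`. -/
lemma mem_SPEX_iff_of_forall {n : ℕ} (hn : 0 < n) {W U : Type*} {H : SimpleGraph W}
    {B : SimpleGraph U} (hne : (SPEX n H).Nonempty)
    (hiso : ∀ G ∈ SPEX n H, Nonempty (G ≃g B)) (G : SimpleGraph (Fin n)) :
    G ∈ SPEX n H ↔ Nonempty (G ≃g B) := by
  refine ⟨hiso G, fun ⟨e⟩ => ?_⟩
  have : Nonempty (Fin n) := ⟨⟨0, hn⟩⟩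
  obtain ⟨G₀, hG₀⟩ := hne
  obtain ⟨e₀⟩ := hiso G₀ hG₀
  have f : G ≃g G₀ := e.trans e₀.symm
  refine ⟨fun h => hG₀.1 (h.of_iso f), fun G' hG' => ?_⟩
  rw [graphSpectralRadius_iso f]
  exact hG₀.2 G' hG'

end Extremal

end SpectralMinor

theorem theorem1p6 (k : ℕ) (hk : 3 ≤ k) (hk4 : k ≠ 4) :
    ∃ N : ℕ, ∀ n : ℕ, N ≤ n →
      (Odd k → ∀ G : SimpleGraph (Fin n),
        G ∈ SpectralMinor.SPEX n (SpectralMinor.wheel k) ↔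
          Nonempty (G ≃g SpectralMinor.book ((k + 1) / 2) (n - (k + 1) / 2))) ∧
      (Even k → ∀ G : SimpleGraph (Fin n),
        G ∈ SpectralMinor.SPEX n (SpectralMinor.wheel k) ↔
          Nonempty (G ≃g SpectralMinor.bookOne ((k + 1) / 2) (n - (k + 1) / 2))) := by
  obtain ⟨N, hN⟩ := SpectralMinor.exists_eq_bookOn k hk hk4
  refine ⟨max N ((k + 1) / 2), fun n hn => ?_⟩
  rw [max_le_iff] at hn
  have hn0 : 0 < n := by omega
  have hne := SpectralMinor.SPEX_wheel_nonempty hk hn.2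
  refine ⟨fun hodd => SpectralMinor.mem_SPEX_iff_of_forall hn0 hne fun G hG => ?_,
    fun heven => SpectralMinor.mem_SPEX_iff_of_forall hn0 hne fun G hG => ?_⟩
  · obtain ⟨L, hL, ⟨-, rfl⟩ | ⟨h, -⟩⟩ := hN n hn.1 G hG
    · exact SpectralMinor.nonempty_bookOn_iso_book (Fintype.card_fin n) hL
    · exact absurd hodd (Nat.not_odd_iff_even.mpr h)
  · obtain ⟨L, hL, ⟨h, -⟩ | ⟨-, p, q, hp, hq, hpq, rfl⟩⟩ := hN n hn.1 G hG
    · exact absurd heven (Nat.not_even_iff_odd.mpr h)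
    · exact SpectralMinor.nonempty_bookOn_iso_bookOne (Fintype.card_fin n) hL hp hq hpq
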